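/- Let $K=\bigoplus_n K_n$ be an evenly graded commutative ring containing $\mathbb{Q}$ (that is, $K_n=0$ for $n$ odd) and let $V$ be a free graded $K$-module with a homogeneous basis. Put $W=\Sigma V^*=\operatorname{Hom}_K(\Sigma V,K)$, where $(\Sigma V)^n=V^{n+1}$, with the dual topological basis and the inverse limit topology ($K$ being discrete). Write $\widehat{T}W=\prod_{n\ge 0}W^{\hat\otimes n}$ for the completed tensor algebra and $\widehat{L}W\subset\widehat{T}W$ for the pro-free graded Lie algebra on $W$, consisting of all convergent infinite linear combinations of Lie monomials. A $C_\infty$-structure on $V$ is a continuous derivation $m:\widehat{L}W\to\widehat{L}W$ of degree one with $m^2=0$. It extends uniquely to a continuous derivation of $\widehat{T}W$, also denoted $m$. * The cyclic Hochschild complex $CC_{\mathrm{Hoch}}(V)$ is the suspension of the complex of those elements of $DR^0_{\mathrm{Ass}}=\widehat{T}W/[\widehat{T}W,\widehat{T}W]$ (the quotient by the closed submodule generated by the graded commutators) which vanish at zero, i.e. of $\prod_{i\ge1}(W^{\hat\otimes i})_{\mathbb{Z}/i}$. Its differential is induced by $m$. * The cyclic Harrison complex $CC_{\mathrm{Harr}}(V)$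 is the suspension of $$DR^0_{\mathrm{Lie}}=\widehat{L}W\,\hat\otimes\,\widehat{L}W\big/\left(x\otimes y=(-1)^{|x||y|}y\otimes x,\ \ x\otimes[y,z]=[x,y]\otimes z\right),$$ where the quotient is by the closed submodule generated by the relations. Its differential is $x\otimes y\mapsto m(x)\otimes y+(-1)^{|x|}x\otimes m(y)$. * The map $l:CC_{\mathrm{Harr}}(V)\to CC_{\mathrm{Hoch}}(V)$ is induced by $x\otimes y\mapsto xy$. * Let $\Delta:\widehat{T}W\to\widehat{T}W\hat\otimes\widehat{T}W$ be the continuous algebra homomorphism with $\Delta(t)=t\otimes1+1\otimes t$ for $t\in W$ (the multiplication of the target following the Koszul sign rule), $\mu$ the multiplication of $\widehat{T}W$ and $s=\mu\Delta$. Let $e(j)$ be the operator on $\widehat{T}W$ which on $W^{\hat\otimes n}$ is zero if $j>n$ and otherwise is the Lagrange interpolation polynomial $$\prod_{0\le r\le n,\ r\ne j}\frac{s-2^r}{2^j-2^r}.$$ The $j=1$ Hodge summand $e^{(1)}CC_{\mathrm{Hoch}}(V)$ is the image of $e(2)$ in $CC_{\mathrm{Hoch}}(V)$, i.e. the suspension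 of $e(2)\left[\prod_{i\ge1}(W^{\hat\otimes i})_{\mathbb{Z}/i}\right]$. Then, for every $C_\infty$-structure on $V$, the map $l$ is a map of complexes, $e^{(1)}CC_{\mathrm{Hoch}}(V)$ is a subcomplex of $CC_{\mathrm{Hoch}}(V)$, and $l$ induces an isomorphism of complexes $$CC_{\mathrm{Harr}}(V)\;\cong\;e^{(1)}CC_{\mathrm{Hoch}}(V)$$ (degree preserving, and continuous in both directions). In particular $l:CC_{\mathrm{Harr}}(V)\to CC_{\mathrm{Hoch}}(V)$ is split: there is a continuous map of complexes $r:CC_{\mathrm{Hoch}}(V)\to CC_{\mathrm{Harr}}(V)$ with $r\circ l=\mathrm{id}$. -/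

import Mathlib

noncomputable section

open Topology Filter

set_option linter.unusedSectionVars false
set_option linter.style.haveILetI false

namespace FormalNC

/-! ### Profinite modules -/

/-- The profinite (= topologically free) `K`-module with topological basis indexed by `X`: the
function `f` stands for the possibly infinite linear combination `∑ₓ f(x) x`. The completed tensor
product of `Pro K X` and `Pro K Y` is `Pro K (X × Y)`. -/
def Pro (K : Type*) (X : Type*) : Type _ := X → K

section Pro

variable {K : Type*} [CommRing K] {X Y Z : Type*}

instance : AddCommGroup (Pro K X) := inferInstanceAs (AddCommGroup (X → K))

instance : Module K (Pro K X) := inferInstanceAs (Module K (X → K))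

/-- The inverse limit topology: a fundamental system of neighbourhoods of zero is given by the
kernels of the projections to finitely many coordinates. -/
instance : TopologicalSpace (Pro K X) := @Pi.topologicalSpace X (fun _ => K) (fun _ => ⊥)

instance : IsTopologicalAddGroup (Pro K X) :=
  letI : TopologicalSpace K := ⊥
  haveI : DiscreteTopology K := ⟨rfl⟩
  inferInstanceAs (IsTopologicalAddGroup (X → K))

instance : ContinuousConstSMul K (Pro K X) :=
  letI : TopologicalSpace K := ⊥
  haveI : DiscreteTopology K := ⟨rfl⟩
  inferInstanceAs (ContinuousConstSMul K (X → K))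

instance : T2Space (Pro K X) :=
  letI : TopologicalSpace K := ⊥
  haveI : DiscreteTopology K := ⟨rfl⟩
  inferInstanceAs (T2Space (X → K))

namespace Pro

theorem ext {f g : Pro K X} (h : ∀ x, f x = g x) : f = g := funext h

@[simp] theorem add_apply (f g : Pro K X) (x : X) : (f + g) x = f x + g x := rfl
@[simp] theorem sub_apply (f g : Pro K X) (x : X) : (f - g) x = f x - g x := rfl
@[simp] theorem neg_apply (f : Pro K X) (x : X) : (-f) x = -f x := rfl
@[simp] theorem zero_apply (x : X) : (0 : Pro K X) x = 0 := rfl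
@[simp] theorem smul_apply (a : K) (f : Pro K X) (x : X) : (a • f) x = a * f x := rfl

open Classical in
/-- The element of the topological basis indexed by `x`. -/
def single (x : X) : Pro K X := fun y => if y = x then 1 else 0

theorem continuous_coord (x : X) : @Continuous (Pro K X) K _ ⊥ (fun f => f x) :=
  letI : TopologicalSpace K := ⊥
  continuous_apply (A := fun _ : X => K) x

theorem continuous_of_coord {T : Type*} [TopologicalSpace T] {A : T → Pro K Y}
    (h : ∀ y, @Continuous T K _ ⊥ (fun a => A a y)) : Continuous A :=
  letI : TopologicalSpace K := ⊥
  continuous_pi (A := fun _ : Y => K) h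

/-- Reindexing, `(pull g f)(x) = f(g(x))`. -/
def pull (g : X → Y) : Pro K Y →L[K] Pro K X where
  toFun f := fun x => f (g x)
  map_add' _ _ := rfl
  map_smul' _ _ := rfl
  cont := continuous_of_coord fun x => continuous_coord (g x)

@[simp] theorem pull_apply (g : X → Y) (f : Pro K Y) (x : X) : pull g f x = f (g x) := rfl

/-- Coordinatewise multiplication by the scalars `c x`. -/
def diag (c : X → K) : Pro K X →L[K] Pro K X where
  toFun f := fun x => c x * f x
  map_add' f g := by funext x; exact mul_add _ _ _
  map_smul' a f := by funext x; exact mul_left_comm _ _ _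
  cont := by
    letI : TopologicalSpace K := ⊥
    haveI : DiscreteTopology K := ⟨rfl⟩
    exact continuous_of_coord fun x => (continuous_coord x).const_mul (c x)

@[simp] theorem diag_apply (c : X → K) (f : Pro K X) (x : X) : diag c f x = c x * f x := rfl

/-- The completed tensor product of two elements. -/
def tmul (f : Pro K X) (g : Pro K Y) : Pro K (X × Y) := fun p => f p.1 * g p.2

@[simp] theorem tmul_apply (f : Pro K X) (g : Pro K Y) (p : X × Y) :
    tmul f g p = f p.1 * g p.2 := rfl

/-- `f ↦ f ⊗ g`. -/
def tmulL (g : Pro K Y) : Pro K X →L[K] Pro K (X × Y) where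
  toFun f := tmul f g
  map_add' f f' := by funext p; exact add_mul _ _ _
  map_smul' a f := by funext p; exact mul_assoc _ _ _
  cont := by
    letI : TopologicalSpace K := ⊥
    haveI : DiscreteTopology K := ⟨rfl⟩
    exact continuous_of_coord fun p => (continuous_coord p.1).mul_const (g p.2)

/-- `g ↦ f ⊗ g`. -/
def tmulR (f : Pro K X) : Pro K Y →L[K] Pro K (X × Y) where
  toFun g := tmul f g
  map_add' g g' := by funext p; exact mul_add _ _ _
  map_smul' a g := by funext p; exact mul_left_comm _ _ _
  cont := by
    letI : TopologicalSpace K := ⊥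
    haveI : DiscreteTopology K := ⟨rfl⟩
    exact continuous_of_coord fun p => (continuous_coord p.2).const_mul (f p.1)

@[simp] theorem tmulL_apply (f : Pro K X) (g : Pro K Y) : tmulL g f = tmul f g := rfl
@[simp] theorem tmulR_apply (f : Pro K X) (g : Pro K Y) : tmulR f g = tmul f g := rfl

theorem smul_tmul' (a : K) (f : Pro K X) (g : Pro K Y) : tmul (a • f) g = a • tmul f g :=
  map_smul (tmulL g) a f
theorem tmul_smul' (a : K) (f : Pro K X) (g : Pro K Y) : tmul f (a • g) = a • tmul f g :=
  map_smul (tmulR f) a g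

theorem single_prod (x : X) (y : Y) :
    (single (x, y) : Pro K (X × Y)) = tmul (single x) (single y) := by
  funext p
  by_cases h1 : p.1 = x <;> by_cases h2 : p.2 = y <;>
    simp [single, tmul, Prod.ext_iff, h1, h2]

/-- The completed tensor product `A ⊗ 1`. -/
def mapL (A : Pro K X →L[K] Pro K Z) : Pro K (X × Y) →L[K] Pro K (Z × Y) where
  toFun F := fun p => A (pull (fun x => (x, p.2)) F) p.1
  map_add' F G := by funext p; simp; rfl
  map_smul' a F := by funext p; simp; rfl
  cont := by
    letI : TopologicalSpace K := ⊥
    exact continuous_of_coord fun p =>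
      (continuous_coord p.1).comp (A.continuous.comp (pull _).continuous)

/-- The completed tensor product `1 ⊗ A`. -/
def mapR (A : Pro K Y →L[K] Pro K Z) : Pro K (X × Y) →L[K] Pro K (X × Z) where
  toFun F := fun p => A (pull (fun y => (p.1, y)) F) p.2
  map_add' F G := by funext p; simp; rfl
  map_smul' a F := by funext p; simp; rfl
  cont := by
    letI : TopologicalSpace K := ⊥
    exact continuous_of_coord fun p =>
      (continuous_coord p.2).comp (A.continuous.comp (pull _).continuous)

theorem mapL_tmul (A : Pro K X →L[K] Pro K Z) (f : Pro K X) (g : Pro K Y) :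
    mapL A (tmul f g) = tmul (A f) g := by
  funext p
  have : pull (fun x => (x, p.2)) (tmul f g) = g p.2 • f := by
    funext x; simp [mul_comm]
  change A (pull (fun x => (x, p.2)) (tmul f g)) p.1 = _
  rw [this]; simp [mul_comm]

theorem mapR_tmul (A : Pro K Y →L[K] Pro K Z) (f : Pro K X) (g : Pro K Y) :
    mapR A (tmul f g) = tmul f (A g) := by
  funext p
  have : pull (fun y => (p.1, y)) (tmul f g) = f p.1 • g := by
    funext x; simp
  change A (pull (fun y => (p.1, y)) (tmul f g)) p.2 = _
  rw [this]; simp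

end Pro

open Pro

/-- The submodule of a profinite module generated by a set, where convergent infinite linear
combinations are allowed. -/
def closedSpan (S : Set (Pro K X)) : Submodule K (Pro K X) :=
  (Submodule.span K S).topologicalClosure

theorem subset_closedSpan (S : Set (Pro K X)) : S ⊆ closedSpan S :=
  fun _ hx => Submodule.le_topologicalClosure _ (Submodule.subset_span hx)

theorem isClosed_closedSpan (S : Set (Pro K X)) : IsClosed (closedSpan S : Set (Pro K X)) :=
  Submodule.isClosed_topologicalClosure _

theorem map_closedSpan {S : Set (Pro K X)} (A : Pro K X →L[K] Pro K Y)
    {T : Submodule K (Pro K Y)} (hT : IsClosed (T : Set (Pro K Y))) (h : ∀ f ∈ S, A f ∈ T) :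
    ∀ f ∈ closedSpan S, A f ∈ T := by
  intro f hf
  exact Submodule.topologicalClosure_minimal (Submodule.span K S)
    (t := T.comap A.toLinearMap) (Submodule.span_le.2 h) (hT.preimage A.continuous) hf

theorem closedSpan_single : closedSpan (Set.range (Pro.single : X → Pro K X)) = ⊤ := by
  classical
  refine eq_top_iff.2 fun f _ => ?_
  have hs : HasSum (fun x => f x • (Pro.single x : Pro K X)) f := by
    letI : TopologicalSpace K := ⊥
    refine (Pi.hasSum (f := fun x => (f x • (Pro.single x : Pro K X) : X → K))).2 fun y => ?_
    have := hasSum_single (f := fun x => f x * (Pro.single x : Pro K X) y) y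
      (fun x hx => by simp [Pro.single, hx.symm])
    simpa [Pro.single] using this
  refine mem_closure_of_tendsto hs (Eventually.of_forall fun s => ?_)
  exact Submodule.sum_mem _ fun x _ => Submodule.smul_mem _ _ (Submodule.subset_span ⟨x, rfl⟩)

theorem mem_of_single (A : Pro K X →L[K] Pro K Y)
    {T : Submodule K (Pro K Y)} (hT : IsClosed (T : Set (Pro K Y)))
    (h : ∀ x, A (single x) ∈ T) (f : Pro K X) : A f ∈ T :=
  map_closedSpan A hT (S := Set.range Pro.single) (by rintro _ ⟨x, rfl⟩; exact h x) f
    (by rw [closedSpan_single]; trivial)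

theorem Pro.hom_ext {A B : Pro K X →L[K] Pro K Y} (h : ∀ x, A (single x) = B (single x)) :
    A = B := by
  ext1 f
  have := mem_of_single (A - B) (T := ⊥) (by simp) (by simpa [sub_eq_zero] using h) f
  simpa [sub_eq_zero] using this

end Pro

/-! ### The completed tensor algebra -/

section Tensor

variable {K : Type*} [CommRing K] {I : Type*}

open Pro

/-- The sign `(-1) ^ n`. -/
def sg (K : Type*) [CommRing K] (n : ℤ) : K := ((n.negOnePow : ℤˣ) : ℤ)

theorem sg_add (m n : ℤ) : sg K (m + n) = sg K m * sg K n := by simp [sg, Int.negOnePow_add]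
@[simp] theorem sg_zero : sg K 0 = 1 := by simp [sg]
theorem sg_even {n : ℤ} (h : Even n) : sg K n = 1 := by simp [sg, Int.negOnePow_even n h]
theorem sg_odd {n : ℤ} (h : Odd n) : sg K n = -1 := by simp [sg, Int.negOnePow_odd n h]
theorem sg_mul_self (n : ℤ) : sg K n * sg K n = 1 := by
  rw [← sg_add]; exact sg_even ⟨n, rfl⟩

/-- The completed tensor algebra `T̂W = K⟨⟨t⟩⟩` of the profinite module `W` with topological basis
`tᵢ`, `i ∈ I`: words in `I` index its topological basis of monomials. The completed tensor power
of order `n` consists of the series supported on words of length `n`. -/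
abbrev TSeries (K I : Type*) := Pro K (List I)

/-- The topological basis element `tᵢ` of `W ⊆ T̂W`. -/
def gen (i : I) : TSeries K I := single [i]

/-- The degree of a monomial, `d i` being the degree of `tᵢ`. -/
def wdeg (d : I → ℤ) (w : List I) : ℤ := (w.map d).sum

@[simp] theorem wdeg_nil (d : I → ℤ) : wdeg d [] = 0 := rfl
@[simp] theorem wdeg_cons (d : I → ℤ) (a : I) (w : List I) :
    wdeg d (a :: w) = d a + wdeg d w := by simp [wdeg]
@[simp] theorem wdeg_append (d : I → ℤ) (u v : List I) :
    wdeg d (u ++ v) = wdeg d u + wdeg d v := by simp [wdeg]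

/-- The associative multiplication `μ : T̂W ⊗ T̂W → T̂W`, concatenation of monomials. -/
def mu : Pro K (List I × List I) →L[K] TSeries K I where
  toFun F := fun w => ∑ k ∈ Finset.range (w.length + 1), F (w.take k, w.drop k)
  map_add' F G := by funext w; exact Finset.sum_add_distrib
  map_smul' a F := by funext w; exact (Finset.mul_sum _ _ _).symm
  cont := by
    letI : TopologicalSpace K := ⊥
    haveI : DiscreteTopology K := ⟨rfl⟩
    exact continuous_of_coord fun w => continuous_finsetSum _ fun k _ => continuous_coord _

theorem mu_apply (F : Pro K (List I × List I)) (w : List I) :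
    mu F w = ∑ k ∈ Finset.range (w.length + 1), F (w.take k, w.drop k) := rfl

theorem mu_nil (F : Pro K (List I × List I)) : mu F [] = F ([], []) := by simp [mu_apply]

theorem mu_cons (F : Pro K (List I × List I)) (a : I) (w : List I) :
    mu F (a :: w) = F ([], a :: w) + mu (pull (fun p : List I × List I => (a :: p.1, p.2)) F) w := by
  rw [mu_apply, mu_apply, List.length_cons, Finset.sum_range_succ']
  simp [add_comm]

/-- The Koszul flip `x ⊗ y ↦ (-1)^{|x||y|} y ⊗ x` of `T̂W ⊗ T̂W`. -/
def swap (d : I → ℤ) : Pro K (List I × List I) →L[K] Pro K (List I × List I) :=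
  (diag fun p => sg K (wdeg d p.1 * wdeg d p.2)).comp (pull Prod.swap)

/-- The product of `T̂W`. -/
def mul (f g : TSeries K I) : TSeries K I := mu (tmul f g)

/-- The graded commutator `[x, y] = xy - (-1)^{|x||y|} yx`, extended bilinearly to
nonhomogeneous elements. -/
def bracket (d : I → ℤ) (f g : TSeries K I) : TSeries K I :=
  mu (tmul f g) - mu (swap d (tmul f g))

/-- `x ↦ (-1)^{k|x|} x`. -/
def twist (d : I → ℤ) (k : ℤ) : TSeries K I →L[K] TSeries K I := diag fun w => sg K (k * wdeg d w)

theorem mu_single (u v : List I) : mu (tmul (single u) (single v)) = (single (u ++ v) : TSeries K I) := by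
  classical
  funext w
  induction u generalizing w with
  | nil =>
    cases w with
    | nil => cases v <;> simp [mu_nil, single]
    | cons b w =>
      have : pull (fun p : List I × List I => (b :: p.1, p.2)) (tmul (single []) (single v) : Pro K (List I × List I)) = 0 := by
        funext p; simp [single]
      simp [mu_cons, this, single]
  | cons a u ih =>
    cases w with
    | nil => simp [mu_nil, single]
    | cons b w =>
      have : pull (fun p : List I × List I => (b :: p.1, p.2)) (tmul (single (a :: u)) (single v) : Pro K (List I × List I))
          = (if b = a then 1 else 0 : K) • tmul (single u) (single v) := by
        funext p; by_cases h : b = a <;> simp [single, h]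
      rw [mu_cons, this, map_smul, Pro.smul_apply, ih]
      by_cases h : b = a <;> simp [single, h]

theorem mul_single (u v : List I) : mul (single u) (single v) = (single (u ++ v) : TSeries K I) :=
  mu_single u v

/-- `f ↦ f g`. -/
def mulL (g : TSeries K I) : TSeries K I →L[K] TSeries K I := mu.comp (tmulL g)
/-- `g ↦ f g`. -/
def mulR (f : TSeries K I) : TSeries K I →L[K] TSeries K I := mu.comp (tmulR f)
@[simp] theorem mulL_apply (f g : TSeries K I) : mulL g f = mul f g := rfl
@[simp] theorem mulR_apply (f g : TSeries K I) : mulR f g = mul f g := rfl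
theorem add_mul' (f g h : TSeries K I) : mul (f + g) h = mul f h + mul g h := map_add (mulL h) f g
theorem mul_add' (f g h : TSeries K I) : mul f (g + h) = mul f g + mul f h := map_add (mulR f) g h
theorem smul_mul' (a : K) (f g : TSeries K I) : mul (a • f) g = a • mul f g := map_smul (mulL g) a f
theorem mul_smul' (a : K) (f g : TSeries K I) : mul f (a • g) = a • mul f g := map_smul (mulR f) a g

theorem mul_assoc' (f g h : TSeries K I) : mul (mul f g) h = mul f (mul g h) := by
  have h1 : ∀ u v : List I, (mulR (mul (single u) (single v)) : TSeries K I →L[K] TSeries K I)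
      = (mulR (single u)).comp (mulR (single v)) := fun u v => hom_ext fun w => by
    simp [mul_single]
  have h2 : ∀ u : List I, (mulL h).comp (mulR (single u) : TSeries K I →L[K] TSeries K I)
      = (mulR (single u)).comp (mulL h) := fun u => hom_ext fun v => congrArg (· h) (h1 u v)
  have h3 : (mulL h).comp (mulL g) = mulL (mul g h) := hom_ext fun u => congrArg (· g) (h2 u)
  exact congrArg (· f) h3

theorem swap_apply (d : I → ℤ) (F : Pro K (List I × List I)) (p : List I × List I) :
    swap d F p = sg K (wdeg d p.1 * wdeg d p.2) * F (p.2, p.1) := rfl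

theorem twist_single (d : I → ℤ) (k : ℤ) (u : List I) :
    twist d k (single u : TSeries K I) = sg K (k * wdeg d u) • single u := by
  funext w
  by_cases h : w = u <;> simp [twist, single, h]

theorem swap_tmul_single (d : I → ℤ) (f : TSeries K I) (v : List I) :
    swap d (tmul f (single v)) = tmul (single v) (twist d (wdeg d v) f) := by
  funext p
  by_cases h : p.1 = v <;> simp [swap_apply, twist, single, h]

theorem swap_single_tmul (d : I → ℤ) (u : List I) (g : TSeries K I) :
    swap d (tmul (single u) g) = tmul (twist d (wdeg d u) g) (single u) := by
  funext p
  by_cases h : p.2 = u <;> simp [swap_apply, twist, single, h, mul_comm]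

/-- `x ↦ [x, y]`. -/
def bracketL (d : I → ℤ) (g : TSeries K I) : TSeries K I →L[K] TSeries K I :=
  (mu - mu.comp (swap d)).comp (tmulL g)
/-- `y ↦ [x, y]`. -/
def bracketR (d : I → ℤ) (f : TSeries K I) : TSeries K I →L[K] TSeries K I :=
  (mu - mu.comp (swap d)).comp (tmulR f)
@[simp] theorem bracketL_apply (d : I → ℤ) (f g : TSeries K I) : bracketL d g f = bracket d f g := rfl
@[simp] theorem bracketR_apply (d : I → ℤ) (f g : TSeries K I) : bracketR d f g = bracket d f g := rfl

theorem bracket_single (d : I → ℤ) (u v : List I) :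
    bracket d (single u) (single v)
      = (single (u ++ v) - sg K (wdeg d u * wdeg d v) • single (v ++ u) : TSeries K I) := by
  rw [bracket, mu_single, swap_tmul_single, twist_single, ← tmulR_apply, map_smul, map_smul,
    tmulR_apply, mu_single, mul_comm (wdeg d v)]

/-! ### The pro-free Lie algebra -/

/-- Lie monomials in the topological basis. -/
inductive IsLieMonomial (d : I → ℤ) : TSeries K I → Prop
  | gen (i : I) : IsLieMonomial d (gen i)
  | bracket (f g : TSeries K I) : IsLieMonomial d f → IsLieMonomial d g →
      IsLieMonomial d (bracket d f g)

/-- The pro-free Lie algebra `L̂W ⊆ T̂W`: all convergent infinite linear combinations of Lie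
monomials. -/
def lieSeries (K : Type*) [CommRing K] (d : I → ℤ) : Submodule K (TSeries K I) :=
  closedSpan {f | IsLieMonomial d f}

theorem gen_mem (d : I → ℤ) (i : I) : gen i ∈ lieSeries K d :=
  subset_closedSpan _ (IsLieMonomial.gen i)

theorem bracket_mem (d : I → ℤ) {f g : TSeries K I} (hf : f ∈ lieSeries K d)
    (hg : g ∈ lieSeries K d) : bracket d f g ∈ lieSeries K d := by
  refine map_closedSpan (bracketL d g) (isClosed_closedSpan _) (fun f hf => ?_) f hf
  refine map_closedSpan (bracketR d f) (isClosed_closedSpan _) (fun g hg => ?_) g hg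
  exact subset_closedSpan _ (IsLieMonomial.bracket f g hf hg)

/-- The Lie bracket of `L̂W`. -/
def lieBracket (d : I → ℤ) (x y : lieSeries K d) : lieSeries K d :=
  ⟨bracket d x y, bracket_mem d x.2 y.2⟩

end Tensor


/-! ### Gradings -/

/-- The grading of the ground ring is concentrated in even degrees. -/
class EvenlyGraded {K : Type*} [CommRing K] (𝒦 : ℤ → AddSubgroup K) : Prop where
  eq_zero_of_odd : ∀ n : ℤ, Odd n → ∀ a ∈ 𝒦 n, a = 0

section Graded

variable {K : Type*} [CommRing K] {I : Type*}

open Pro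

/-- The elements of degree `n` in `Pro K X`, where the basis element `x` has degree `δ x`. -/
def homog {X : Type*} (𝒦 : ℤ → AddSubgroup K) (δ : X → ℤ) (n : ℤ) : AddSubgroup (Pro K X) where
  carrier := {f | ∀ x, f x ∈ 𝒦 (n - δ x)}
  add_mem' hf hg x := (𝒦 _).add_mem (hf x) (hg x)
  zero_mem' _ := (𝒦 _).zero_mem
  neg_mem' hf x := (𝒦 _).neg_mem (hf x)

theorem mem_homog {X : Type*} {𝒦 : ℤ → AddSubgroup K} {δ : X → ℤ} {n : ℤ} {f : Pro K X} :
    f ∈ homog 𝒦 δ n ↔ ∀ x, f x ∈ 𝒦 (n - δ x) := Iff.rfl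

theorem single_mem_homog {X : Type*} (𝒦 : ℤ → AddSubgroup K) [GradedRing 𝒦] (δ : X → ℤ) (x : X) :
    (single x : Pro K X) ∈ homog 𝒦 δ (δ x) := by
  intro y
  by_cases h : y = x
  · subst h
    simpa [single] using SetLike.GradedOne.one_mem (A := 𝒦)
  · simp [single, h]

theorem sg_mul_mem (𝒦 : ℤ → AddSubgroup K) (k n : ℤ) {a : K} (ha : a ∈ 𝒦 n) :
    sg K k * a ∈ 𝒦 n := by
  rcases Int.even_or_odd k with h | h
  · simpa [sg_even h] using ha
  · simpa [sg_odd h] using ha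

/-- A homological vector field on the pro-free Lie algebra `L̂W`: a continuous derivation of degree
one and square zero. Here `d i` is the degree of the topological basis element `tᵢ` of `W`. -/
structure HomologicalLieField (𝒦 : ℤ → AddSubgroup K) (d : I → ℤ) where
  /-- the vector field -/
  m : lieSeries K d →L[K] lieSeries K d
  degree_one : ∀ (n : ℤ) (x : lieSeries K d), (x : TSeries K I) ∈ homog 𝒦 (wdeg d) n →
    (m x : TSeries K I) ∈ homog 𝒦 (wdeg d) (n + 1)
  derivation : ∀ (n : ℤ) (x y : lieSeries K d), (x : TSeries K I) ∈ homog 𝒦 (wdeg d) n →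
    m (lieBracket d x y) = lieBracket d (m x) y + sg K n • lieBracket d x (m y)
  sq_zero : ∀ x, m (m x) = 0

theorem IsLieMonomial.exists_deg {d : I → ℤ} {f : TSeries K I} (hf : IsLieMonomial d f) :
    ∃ n, ∀ w, wdeg d w ≠ n → f w = 0 := by
  induction hf with
  | gen i =>
    refine ⟨d i, fun w hw => ?_⟩
    have : w ≠ [i] := by rintro rfl; simp at hw
    simp [FormalNC.gen, single, this]
  | bracket f g _ _ ihf ihg =>
    obtain ⟨n, hn⟩ := ihf
    obtain ⟨k, hk⟩ := ihg
    refine ⟨n + k, fun w hw => ?_⟩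
    have key : ∀ j, (f (w.take j) = 0 ∨ g (w.drop j) = 0) ∧
        (f (w.drop j) = 0 ∨ g (w.take j) = 0) := by
      intro j
      have hj : wdeg d (w.take j) + wdeg d (w.drop j) = wdeg d w := by
        rw [← wdeg_append, List.take_append_drop]
      constructor
      · by_contra! h
        have h1 := not_imp_comm.1 (hn _) h.1
        have h2 := not_imp_comm.1 (hk _) h.2
        omega
      · by_contra! h
        have h1 := not_imp_comm.1 (hn _) h.1
        have h2 := not_imp_comm.1 (hk _) h.2
        omega
    simp only [FormalNC.bracket, Pro.sub_apply, mu_apply]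
    rw [Finset.sum_eq_zero, Finset.sum_eq_zero, sub_zero]
    · intro j _
      rcases (key j).2 with h | h <;> simp [swap_apply, h]
    · intro j _
      rcases (key j).1 with h | h <;> simp [h]

theorem IsLieMonomial.nil {d : I → ℤ} {f : TSeries K I} (hf : IsLieMonomial d f) : f [] = 0 := by
  induction hf with
  | gen i => simp [FormalNC.gen, single]
  | bracket f g _ _ ihf ihg =>
    simp [FormalNC.bracket, mu_nil, swap_apply, ihf, ihg]

theorem nil_of_mem_lieSeries {d : I → ℤ} {f : TSeries K I} (hf : f ∈ lieSeries K d) : f [] = 0 := by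
  let A : TSeries K I →L[K] Pro K Unit := pull fun _ => []
  have h : A f ∈ (⊥ : Submodule K (Pro K Unit)) :=
    map_closedSpan A (T := (⊥ : Submodule K (Pro K Unit))) (by simp)
      (S := {f | IsLieMonomial d f})
      (fun f hf => (Submodule.mem_bot K).2 (Pro.ext fun _ => IsLieMonomial.nil hf)) f hf
  rw [Submodule.mem_bot] at h
  exact congrFun h ()

theorem twist_of_supp {d : I → ℤ} {f : TSeries K I} {n : ℤ} (hf : ∀ w, wdeg d w ≠ n → f w = 0)
    (k : ℤ) : twist d k f = sg K (k * n) • f := by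
  funext w
  by_cases h : wdeg d w = n
  · simp [twist, h]
  · simp [twist, hf w h]

theorem twist_mem_lieSeries {d : I → ℤ} {f : TSeries K I} (k : ℤ) (hf : f ∈ lieSeries K d) :
    twist d k f ∈ lieSeries K d := by
  refine map_closedSpan (twist d k) (isClosed_closedSpan _) (fun f hf => ?_) f hf
  obtain ⟨n, hn⟩ := IsLieMonomial.exists_deg hf
  rw [twist_of_supp hn]
  exact Submodule.smul_mem _ _ (subset_closedSpan _ hf)

namespace HomologicalLieField

variable {𝒦 : ℤ → AddSubgroup K} {d : I → ℤ} (Q : HomologicalLieField 𝒦 d)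

/-- `m(tᵢ)`. -/
def onGen (i : I) : TSeries K I := Q.m ⟨gen i, gen_mem d i⟩

theorem finite_coeff (v : List I) : (Function.support fun i => Q.onGen i v).Finite := by
  letI : TopologicalSpace K := ⊥
  haveI : DiscreteTopology K := ⟨rfl⟩
  have h1 : Tendsto (fun i => (⟨gen i, gen_mem d i⟩ : lieSeries K d)) cofinite (𝓝 0) := by
    rw [tendsto_subtype_rng]
    refine tendsto_pi_nhds.2 fun w => ?_
    have hfin : {i : I | w = [i]}.Finite :=
      Set.Subsingleton.finite fun i (hi : w = [i]) j (hj : w = [j]) => by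
        rw [hi] at hj; simpa using hj
    have hev : ∀ᶠ i in cofinite, (0 : K) = (gen i : TSeries K I) w := by
      filter_upwards [hfin.compl_mem_cofinite] with i hi
      have hi' : w ≠ [i] := hi
      simp [gen, single, hi']
    exact tendsto_const_nhds.congr' hev
  have h2 := (Q.m.continuous.tendsto 0).comp h1
  rw [map_zero] at h2
  have h3 := ((continuous_coord (K := K) v).comp continuous_subtype_val).tendsto
    (0 : lieSeries K d) |>.comp h2
  have h4 : ∀ᶠ i in cofinite, Q.onGen i v = 0 := by
    have := h3.eventually (isOpen_discrete ({0} : Set K) |>.mem_nhds (by simp))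
    exact this
  exact h4

/-- For a word `v`, the finitely supported family of the coefficients of `v` in the series
`m(tᵢ)`. -/
def coeff (v : List I) : I →₀ K := Finsupp.ofSupportFinite (fun i => Q.onGen i v) (Q.finite_coeff v)

@[simp] theorem coeff_apply (v : List I) (i : I) : Q.coeff v i = Q.onGen i v := rfl

/-- The operator `f ↦ ∑ᵢ m(tᵢ) ⊗ ∂ᵢ f`, where `∂ᵢ` strips the letter `i` from the left of a
monomial (and kills the monomials which do not begin with `i`). -/
def splitHead : TSeries K I →L[K] Pro K (List I × List I) where
  toFun f := fun p => (Q.coeff p.1).sum fun i a => a * f (i :: p.2)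
  map_add' f g := by
    funext p
    change ((Q.coeff p.1).sum fun i a => a * (f + g) (i :: p.2)) =
      ((Q.coeff p.1).sum fun i a => a * f (i :: p.2)) +
        (Q.coeff p.1).sum fun i a => a * g (i :: p.2)
    simp [Finsupp.sum, mul_add, Finset.sum_add_distrib]
  map_smul' b f := by
    funext p
    change ((Q.coeff p.1).sum fun i a => a * (b • f) (i :: p.2)) =
      b * (Q.coeff p.1).sum fun i a => a * f (i :: p.2)
    simp [Finsupp.sum, Finset.mul_sum, mul_left_comm]
  cont := by
    letI : TopologicalSpace K := ⊥
    haveI : DiscreteTopology K := ⟨rfl⟩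
    exact continuous_of_coord fun p => continuous_finsetSum _ fun i _ =>
      (continuous_coord _).const_mul _

theorem splitHead_apply (f : TSeries K I) (p : List I × List I) :
    Q.splitHead f p = (Q.coeff p.1).sum fun i a => a * f (i :: p.2) := rfl

/-- The operator `f ↦ ∑ᵢ m(tᵢ) ∂ᵢ f`. -/
def headOp : TSeries K I →L[K] TSeries K I := mu.comp Q.splitHead

/-- The coefficients of the extension of `m` to `T̂W`, given by the recursion
`m(tᵢ f) = m(tᵢ) f + (-1)^{|tᵢ|} tᵢ m(f)`. -/
def extendFun : TSeries K I → List I → K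
  | f, [] => Q.headOp f []
  | f, a :: w => Q.headOp f (a :: w) + sg K (d a) * extendFun (pull (fun w => a :: w) f) w

/-- The unique extension of the vector field `m` on `L̂W` to a continuous derivation of `T̂W`. -/
def extend : TSeries K I →L[K] TSeries K I where
  toFun f := fun w => Q.extendFun f w
  map_add' f g := by
    funext w
    change Q.extendFun (f + g) w = Q.extendFun f w + Q.extendFun g w
    induction w generalizing f g with
    | nil => simp [extendFun]
    | cons a w ih => simp only [extendFun, map_add, ih, Pro.add_apply]; ring
  map_smul' b f := by
    funext w
    change Q.extendFun (b • f) w = b * Q.extendFun f w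
    induction w generalizing f with
    | nil => simp [extendFun]
    | cons a w ih => simp only [extendFun, map_smul, ih, Pro.smul_apply]; ring
  cont := by
    letI : TopologicalSpace K := ⊥
    haveI : DiscreteTopology K := ⟨rfl⟩
    refine continuous_of_coord fun w => ?_
    change Continuous fun f => Q.extendFun f w
    induction w with
    | nil => exact (continuous_coord _).comp Q.headOp.continuous
    | cons a w ih =>
      exact ((continuous_coord _).comp Q.headOp.continuous).add
        ((ih.comp (pull _).continuous).const_mul _)

theorem extend_nil (f : TSeries K I) : Q.extend f [] = Q.headOp f [] := rfl

theorem extend_cons (f : TSeries K I) (a : I) (w : List I) : Q.extend f (a :: w) =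
    Q.headOp f (a :: w) + sg K (d a) * Q.extend (pull (fun w => a :: w) f) w := rfl

theorem headOp_single_nil : Q.headOp (single []) = 0 := by
  have : Q.splitHead (single []) = 0 := by
    funext p
    simp [splitHead_apply, single]
  rw [headOp, ContinuousLinearMap.comp_apply, this, map_zero]

theorem headOp_single_cons (a : I) (w : List I) :
    Q.headOp (single (a :: w)) = mul (Q.onGen a) (single w) := by
  classical
  rw [headOp, ContinuousLinearMap.comp_apply, mul]
  congr 1
  funext p
  rw [splitHead_apply, Finsupp.sum, Finset.sum_eq_single a]
  · simp [single]
  · intro b _ hb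
    simp [single, hb]
  · intro h
    rw [Finsupp.notMem_support_iff] at h
    simp [h]

theorem extend_single_nil : Q.extend (single []) = 0 := by
  funext w
  cases w with
  | nil => rw [extend_nil, headOp_single_nil]
  | cons b w =>
    have : pull (fun w => b :: w) (single [] : TSeries K I) = 0 := by funext w; simp [single]
    rw [extend_cons, headOp_single_nil, this]; simp

theorem extend_single_cons (a : I) (w : List I) : Q.extend (single (a :: w)) =
    mul (Q.onGen a) (single w) + sg K (d a) • mul (gen a) (Q.extend (single w)) := by
  classical
  funext v
  cases v with
  | nil => simp [extend_nil, headOp_single_cons, mul, mu_nil, gen, single]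
  | cons b v =>
    have h1 : pull (fun v => b :: v) (single (a :: w) : TSeries K I)
        = (if b = a then 1 else 0 : K) • single w := by
      funext v; by_cases h : b = a <;> simp [single, h]
    have h2 : pull (fun p : List I × List I => (b :: p.1, p.2)) (tmul (gen a) (Q.extend (single w)))
        = (if b = a then 1 else 0 : K) • tmul (single []) (Q.extend (single w)) := by
      funext p; by_cases h : b = a <;> simp [gen, single, h]
    have h3 : ∀ f : TSeries K I, mul (single []) f = f := fun f => by
      have : (mulR (single []) : TSeries K I →L[K] _) = ContinuousLinearMap.id K _ :=
        hom_ext fun x => by simp [mul_single]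
      exact congrArg (· f) this
    rw [extend_cons, headOp_single_cons, h1, Pro.add_apply, Pro.smul_apply, mul.eq_1 (gen a),
      mu_cons, h2, map_smul, map_smul, ← mul.eq_1, h3]
    by_cases h : b = a <;> simp [gen, single, h]

theorem onGen_mem (i : I) : Q.onGen i ∈ lieSeries K d := (Q.m _).2

theorem extend_gen (i : I) : Q.extend (gen i) = Q.onGen i := by
  have h3 : ∀ f : TSeries K I, mul f (single []) = f := fun f => by
    have : (mulL (single []) : TSeries K I →L[K] _) = ContinuousLinearMap.id K _ :=
      hom_ext fun x => by simp [mul_single]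
    exact congrArg (· f) this
  rw [gen, extend_single_cons, extend_single_nil, h3, ← mulR_apply, map_zero, smul_zero, add_zero]

theorem extend_nil_eq_zero (f : TSeries K I) : Q.extend f [] = 0 := by
  rw [extend_nil, headOp, ContinuousLinearMap.comp_apply, mu_nil, splitHead_apply]
  refine Finset.sum_eq_zero fun i _ => ?_
  simp [nil_of_mem_lieSeries (Q.onGen_mem i)]

/-- The operator `m ⊗ 1 + 1 ⊗ m` on `T̂W ⊗ T̂W`, i.e.
`x ⊗ y ↦ m(x) ⊗ y + (-1)^{|x|} x ⊗ m(y)`. -/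
def tensorOp : Pro K (List I × List I) →L[K] Pro K (List I × List I) :=
  mapL Q.extend + (mapR Q.extend).comp (diag fun p => sg K (wdeg d p.1))

theorem tensorOp_tmul (f g : TSeries K I) : Q.tensorOp (tmul f g) =
    tmul (Q.extend f) g + tmul (twist d 1 f) (Q.extend g) := by
  have : diag (fun p : List I × List I => sg K (wdeg d p.1)) (tmul f g) = tmul (twist d 1 f) g := by
    funext p; simp [twist, mul_assoc]
  simp [tensorOp, mapL_tmul, mapR_tmul, this]

theorem twist_mul (k : ℤ) (f g : TSeries K I) :
    twist d k (mul f g) = mul (twist d k f) (twist d k g) := by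
  have h1 : ∀ u : List I, (twist d k).comp (mulR (single u) : TSeries K I →L[K] _)
      = (mulR (twist d k (single u))).comp (twist d k) := fun u => hom_ext fun v => by
    simp [mul_single, twist_single, mul_add, sg_add, smul_mul', smul_smul, mul_comm]
  have h2 : (twist d k).comp (mulL g) = (mulL (twist d k g)).comp (twist d k) :=
    hom_ext fun u => congrArg (· g) (h1 u)
  exact congrArg (· f) h2

theorem extend_mu (F : Pro K (List I × List I)) : Q.extend (mu F) = mu (Q.tensorOp F) := by
  have : (Q.extend.comp mu) = mu.comp Q.tensorOp := hom_ext fun p => by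
    obtain ⟨u, v⟩ := p
    rw [single_prod]
    simp only [ContinuousLinearMap.comp_apply, tensorOp_tmul, mu_single, map_add, twist_single]
    rw [← tmulL_apply (sg K _ • _), map_smul, map_smul, tmulL_apply]
    change _ = mul (Q.extend (single u)) (single v) + sg K _ • mul (single u) (Q.extend (single v))
    induction u with
    | nil =>
      have h3 : ∀ f : TSeries K I, mul (single []) f = f := fun f => by
        have : (mulR (single []) : TSeries K I →L[K] _) = ContinuousLinearMap.id K _ :=
          hom_ext fun x => by simp [mul_single]
        exact congrArg (· f) this
      rw [extend_single_nil, ← mulL_apply, map_zero, h3]; simp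
    | cons a u ih =>
      rw [List.cons_append, extend_single_cons, ih, extend_single_cons, add_mul', smul_mul',
        mul_assoc', mul_assoc', mul_single, mul_add', mul_smul', ← mul_assoc' (gen a) (single u), gen, mul_single]
      simp only [wdeg_cons, one_mul, sg_add, smul_add, smul_smul, List.singleton_append]
      abel
  exact congrArg (· F) this

/-- The Leibniz rule. -/
theorem extend_mul (f g : TSeries K I) :
    Q.extend (mul f g) = mul (Q.extend f) g + mul (twist d 1 f) (Q.extend g) := by
  rw [mul, extend_mu, tensorOp_tmul, map_add]; rfl

theorem bracket_eq (f g : TSeries K I) : bracket d f g = mu (tmul f g - swap d (tmul f g)) := by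
  rw [map_sub]; rfl

theorem twist_bracket (k : ℤ) (f g : TSeries K I) :
    twist d k (bracket d f g) = bracket d (twist d k f) (twist d k g) := by
  have h1 : ∀ u : List I, (twist d k).comp (bracketR d (single u) : TSeries K I →L[K] _)
      = (bracketR d (twist d k (single u))).comp (twist d k) := fun u => hom_ext fun v => by
    simp only [ContinuousLinearMap.comp_apply, bracketR_apply, twist_single, map_smul]
    rw [← bracketL_apply _ (sg K _ • _), map_smul, bracketL_apply, bracket_single, map_sub, map_smul, twist_single,
      twist_single, smul_sub, smul_sub]
    simp only [smul_smul, wdeg_append, mul_add, sg_add]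
    congr 2 <;> ring
  have h2 : (twist d k).comp (bracketL d g) = (bracketL d (twist d k g)).comp (twist d k) :=
    hom_ext fun u => congrArg (· g) (h1 u)
  exact congrArg (· f) h2

section Even

variable [GradedRing 𝒦] [EvenlyGraded 𝒦]

theorem splitHead_mem {n : ℤ} {f : TSeries K I} (hf : f ∈ homog 𝒦 (wdeg d) n)
    (p : List I × List I) : Q.splitHead f p ∈ 𝒦 (n + 1 - (wdeg d p.1 + wdeg d p.2)) := by
  rw [splitHead_apply]
  refine sum_mem fun i _ => ?_
  have h1 : Q.onGen i p.1 ∈ 𝒦 (d i + 1 - wdeg d p.1) := by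
    have h0 : (gen i : TSeries K I) ∈ homog 𝒦 (wdeg d) (d i) := by
      simpa [gen] using single_mem_homog (K := K) 𝒦 (wdeg d) [i]
    exact Q.degree_one (d i) ⟨gen i, gen_mem d i⟩ h0 p.1
  have h2 := SetLike.GradedMul.mul_mem h1 (hf (i :: p.2))
  rw [coeff_apply]
  convert h2 using 2
  rw [wdeg_cons]; ring

theorem headOp_mem {n : ℤ} {f : TSeries K I} (hf : f ∈ homog 𝒦 (wdeg d) n) :
    Q.headOp f ∈ homog 𝒦 (wdeg d) (n + 1) := by
  intro w
  rw [headOp, ContinuousLinearMap.comp_apply, mu_apply]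
  refine sum_mem fun k _ => ?_
  have := Q.splitHead_mem hf (w.take k, w.drop k)
  rwa [← wdeg_append, List.take_append_drop] at this

theorem extend_mem {n : ℤ} {f : TSeries K I} (hf : f ∈ homog 𝒦 (wdeg d) n) :
    Q.extend f ∈ homog 𝒦 (wdeg d) (n + 1) := by
  intro w
  induction w generalizing f n with
  | nil => exact Q.headOp_mem hf []
  | cons a w ih =>
    rw [extend_cons]
    refine add_mem (Q.headOp_mem hf _) (sg_mul_mem 𝒦 _ _ ?_)
    have h1 : pull (fun w => a :: w) f ∈ homog 𝒦 (wdeg d) (n - d a) := fun v => by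
      have := hf (a :: v)
      rw [pull_apply]
      convert this using 2
      rw [wdeg_cons]; ring
    have := ih h1
    convert this using 2
    rw [wdeg_cons]; ring

theorem twist_of_homog {n : ℤ} {f : TSeries K I} (hf : f ∈ homog 𝒦 (wdeg d) n) (k : ℤ) :
    twist d k f = sg K (k * n) • f := by
  funext w
  change sg K (k * wdeg d w) * f w = sg K (k * n) * f w
  rcases Int.even_or_odd (n - wdeg d w) with h | h
  · have : k * n = k * wdeg d w + k * (n - wdeg d w) := by ring
    rw [this, sg_add, sg_even (h.mul_left k), mul_one]
  · rw [EvenlyGraded.eq_zero_of_odd (𝒦 := 𝒦) _ h _ (hf w), mul_zero, mul_zero]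

theorem extend_twist (k : ℤ) (f : TSeries K I) :
    Q.extend (twist d k f) = sg K k • twist d k (Q.extend f) := by
  have : Q.extend.comp (twist d k) = sg K k • (twist d k).comp Q.extend := hom_ext fun u => by
    have hu := single_mem_homog (K := K) 𝒦 (wdeg d) u
    simp only [ContinuousLinearMap.comp_apply, _root_.smul_apply]
    rw [twist_of_homog hu, twist_of_homog (Q.extend_mem hu), map_smul, smul_smul, mul_add,
      sg_add, mul_one, mul_comm (sg K k), mul_assoc, sg_mul_self, mul_one]
  exact congrArg (· f) this

theorem tensorOp_swap (F : Pro K (List I × List I)) :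
    Q.tensorOp (swap d F) = swap d (Q.tensorOp F) := by
  have : Q.tensorOp.comp (swap d) = (swap d).comp Q.tensorOp := hom_ext fun p => by
    obtain ⟨u, v⟩ := p
    have h1 : twist d (wdeg d v) (Q.extend (single u)) =
        (sg K (wdeg d v) * sg K (wdeg d u * wdeg d v)) • Q.extend (single u) := by
      have := Q.extend_twist (wdeg d v) (single u)
      rw [twist_single, map_smul] at this
      rw [mul_comm (wdeg d u), mul_smul, this, smul_smul, sg_mul_self, one_smul]
    have h2 : twist d (wdeg d u) (Q.extend (single v)) =
        (sg K (wdeg d u) * sg K (wdeg d u * wdeg d v)) • Q.extend (single v) := by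
      have := Q.extend_twist (wdeg d u) (single v)
      rw [twist_single, map_smul] at this
      rw [mul_smul, this, smul_smul, sg_mul_self, one_smul]
    simp only [ContinuousLinearMap.comp_apply]
    rw [single_prod, swap_tmul_single, twist_single, tmul_smul', map_smul, tensorOp_tmul,
      tensorOp_tmul, map_add, swap_tmul_single, h1, twist_single, twist_single, smul_tmul',
      smul_tmul', map_smul, swap_single_tmul, h2, tmul_smul', smul_tmul', smul_add,
      smul_smul, smul_smul, one_mul, one_mul, mul_comm (wdeg d v) (wdeg d u), ← mul_assoc,
      sg_mul_self, one_mul, mul_comm (sg K (wdeg d v)), add_comm]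
  exact congrArg (· F) this

/-- The Leibniz rule for the graded commutator. -/
theorem extend_bracket (f g : TSeries K I) : Q.extend (bracket d f g) =
    bracket d (Q.extend f) g + bracket d (twist d 1 f) (Q.extend g) := by
  rw [bracket_eq, extend_mu, map_sub, tensorOp_swap, tensorOp_tmul, bracket_eq, bracket_eq,
    map_add (swap d), add_sub_add_comm, map_add]

/-- `Q.extend` indeed extends the vector field on `L̂W`. -/
theorem extend_coe (x : lieSeries K d) : Q.extend x = Q.m x := by
  have hmono : ∀ f : TSeries K I, IsLieMonomial d f →
      (∃ n, f ∈ homog 𝒦 (wdeg d) n) ∧ ∀ hf : f ∈ lieSeries K d, Q.extend f = Q.m ⟨f, hf⟩ := by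
    intro f hf
    induction hf with
    | gen i =>
      exact ⟨⟨_, single_mem_homog (K := K) 𝒦 (wdeg d) [i]⟩, fun _ => Q.extend_gen i⟩
    | bracket f g hf hg ihf ihg =>
      obtain ⟨⟨n, hn⟩, ihf⟩ := ihf
      obtain ⟨⟨k, hk⟩, ihg⟩ := ihg
      have hfL : f ∈ lieSeries K d := subset_closedSpan _ hf
      have hgL : g ∈ lieSeries K d := subset_closedSpan _ hg
      refine ⟨⟨n + k, fun w => ?_⟩, fun hb => ?_⟩
      · change mu (tmul f g) w - mu (swap d (tmul f g)) w ∈ _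
        rw [mu_apply, mu_apply]
        refine sub_mem (sum_mem fun j _ => ?_) (sum_mem fun j _ => ?_)
        · have := SetLike.GradedMul.mul_mem (hn (w.take j)) (hk (w.drop j))
          rw [tmul_apply]
          convert this using 2
          have : wdeg d w = wdeg d (w.take j) + wdeg d (w.drop j) := by
            rw [← wdeg_append, List.take_append_drop]
          rw [this]; ring
        · have := SetLike.GradedMul.mul_mem (hn (w.drop j)) (hk (w.take j))
          rw [swap_apply, tmul_apply]
          refine sg_mul_mem 𝒦 _ _ ?_
          convert this using 2
          have : wdeg d w = wdeg d (w.take j) + wdeg d (w.drop j) := by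
            rw [← wdeg_append, List.take_append_drop]
          rw [this]; ring
      · have h := Q.derivation n ⟨f, hfL⟩ ⟨g, hgL⟩ hn
        have h' := congrArg (Subtype.val) h
        change (Q.m ⟨bracket d f g, _⟩ : TSeries K I) = bracket d (Q.m ⟨f, hfL⟩) g +
          sg K n • bracket d f (Q.m ⟨g, hgL⟩) at h'
        rw [h', extend_bracket, ihf hfL, ihg hgL, twist_of_homog hn, one_mul,
          ← bracketL_apply _ (sg K n • f), map_smul, bracketL_apply]
  let E : Submodule K (lieSeries K d) :=
    (Q.extend.comp (lieSeries K d).subtypeL - (lieSeries K d).subtypeL.comp Q.m).ker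
  have hE : IsClosed (E : Set (lieSeries K d)) :=
    isClosed_singleton.preimage (ContinuousLinearMap.continuous _)
  have hx : x ∈ closure (E : Set (lieSeries K d)) := by
    rw [closure_subtype]
    refine closure_mono ?_ x.2
    intro f hf
    have hfL : f ∈ lieSeries K d := Submodule.le_topologicalClosure _ hf
    have : Submodule.span K {f : TSeries K I | IsLieMonomial d f} ≤
        E.map (lieSeries K d).subtype := by
      refine Submodule.span_le.2 fun f hf => ?_
      refine ⟨⟨f, subset_closedSpan _ hf⟩, ?_, rfl⟩
      exact sub_eq_zero.2 ((hmono f hf).2 _)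
    exact this hf
  rw [hE.closure_eq] at hx
  exact sub_eq_zero.1 hx

theorem extend_mem_lie {x : TSeries K I} (hx : x ∈ lieSeries K d) :
    Q.extend x ∈ lieSeries K d := by
  rw [show Q.extend x = Q.m ⟨x, hx⟩ from Q.extend_coe ⟨x, hx⟩]
  exact (Q.m _).2

theorem extend_extend (f : TSeries K I) : Q.extend (Q.extend f) = 0 := by
  have : Q.extend.comp Q.extend = 0 := hom_ext fun u => by
    change Q.extend (Q.extend (single u)) = 0
    induction u with
    | nil => rw [extend_single_nil, map_zero]
    | cons a u ih =>
      have h1 : Q.extend (Q.onGen a) = 0 := by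
        rw [Q.extend_coe ⟨Q.onGen a, Q.onGen_mem a⟩]
        exact congrArg Subtype.val (Q.sq_zero ⟨gen a, gen_mem d a⟩)
      have hg : (gen a : TSeries K I) ∈ homog 𝒦 (wdeg d) (d a) := by
        simpa [gen] using single_mem_homog (K := K) 𝒦 (wdeg d) [a]
      have h2 : Q.onGen a ∈ homog 𝒦 (wdeg d) (d a + 1) := Q.degree_one _ ⟨gen a, gen_mem d a⟩ hg
      rw [extend_single_cons, map_add, map_smul, extend_mul, extend_mul, h1, ih, extend_gen,
        twist_of_homog h2, twist_of_homog hg, ← mulL_apply 0, map_zero, zero_add,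
        ← mulR_apply _ 0, map_zero, add_zero, smul_mul', one_mul, sg_add,
        show sg K 1 = -1 from sg_odd odd_one, ← add_smul]
      simp
  exact congrArg (· f) this

theorem tensorOp_tensorOp (F : Pro K (List I × List I)) : Q.tensorOp (Q.tensorOp F) = 0 := by
  have : Q.tensorOp.comp Q.tensorOp = 0 := hom_ext fun p => by
    obtain ⟨u, v⟩ := p
    change Q.tensorOp (Q.tensorOp (single (u, v))) = 0
    rw [single_prod, tensorOp_tmul, map_add, tensorOp_tmul, tensorOp_tmul, extend_extend,
      extend_extend, extend_twist, show sg K 1 = -1 from sg_odd odd_one, ← tmulL_apply 0, map_zero,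
      ← tmulR_apply _ 0, map_zero, smul_tmul']
    simp
  exact congrArg (· F) this

theorem tensorOp_homog {n : ℤ} {F : Pro K (List I × List I)}
    (hF : F ∈ homog 𝒦 (fun p : List I × List I => wdeg d p.1 + wdeg d p.2) n) :
    Q.tensorOp F ∈ homog 𝒦 (fun p : List I × List I => wdeg d p.1 + wdeg d p.2) (n + 1) := by
  rintro ⟨u, v⟩
  refine add_mem ?_ ?_
  · have h : pull (fun x => (x, v)) F ∈ homog 𝒦 (wdeg d) (n - wdeg d v) := fun w => by
      have := hF (w, v)
      rw [pull_apply]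
      convert this using 2
      ring
    have := Q.extend_mem h u
    change Q.extend (pull (fun x => (x, v)) F) u ∈ _
    convert this using 2
    ring
  · let G : Pro K (List I × List I) := diag (fun p => sg K (wdeg d p.1)) F
    have h : pull (fun y => (u, y)) G ∈ homog 𝒦 (wdeg d) (n - wdeg d u) := fun w => by
      have := sg_mul_mem 𝒦 (wdeg d u) _ (hF (u, w))
      rw [pull_apply]
      change sg K (wdeg d u) * F (u, w) ∈ _
      convert this using 2
      ring
    have := Q.extend_mem h v
    change Q.extend (pull (fun y => (u, y)) G) v ∈ _
    convert this using 2
    ring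

end Even

end HomologicalLieField

end Graded


/-! ### Complexes -/

universe u v

/-- A cochain complex of topological graded `K`-modules; `gr n` consists of the elements of
degree `n`. -/
structure TopComplex (K : Type u) [CommRing K] where
  carrier : Type v
  [addCommGroup : AddCommGroup carrier]
  [module : Module K carrier]
  [topologicalSpace : TopologicalSpace carrier]
  /-- the homogeneous elements -/
  gr : ℤ → AddSubgroup carrier
  /-- the differential -/
  d : carrier →L[K] carrier
  d_mem : ∀ n, ∀ x ∈ gr n, d x ∈ gr (n + 1)
  d_d : ∀ x, d (d x) = 0

namespace TopComplex

instance {K : Type u} [CommRing K] : CoeSort (TopComplex.{u, v} K) (Type v) := ⟨carrier⟩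

attribute [instance] addCommGroup module topologicalSpace

variable {K : Type u} [CommRing K]

/-- A continuous linear map is a map of complexes if it preserves degrees and commutes with the
differentials. -/
structure IsChainMap {C D : TopComplex K} (f : C →L[K] D) : Prop where
  map_gr : ∀ n, ∀ x ∈ C.gr n, f x ∈ D.gr n
  map_d : ∀ x, f (C.d x) = D.d (f x)

/-- The subcomplex on a submodule stable under the differential, with the subspace topology. -/
def sub (C : TopComplex.{u, v} K) (S : Submodule K C) (h : ∀ x ∈ S, C.d x ∈ S) :
    TopComplex.{u, v} K where
  carrier := S
  gr n := (C.gr n).comap S.subtype.toAddMonoidHom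
  d := (C.d.comp S.subtypeL).codRestrict S fun x => h x x.2
  d_mem n x hx := C.d_mem n x hx
  d_d x := Subtype.ext (C.d_d x)

/-- The inclusion of a subcomplex. -/
def subIncl (C : TopComplex.{u, v} K) (S : Submodule K C) (h : ∀ x ∈ S, C.d x ∈ S) :
    C.sub S h →L[K] C := S.subtypeL

end TopComplex

/-! ### Cyclic complexes -/

section Cyclic

variable {K : Type u} [CommRing K] {I : Type v}

open Pro

/-- The module of commutators `[T̂W, T̂W]`. -/
def commutators (K : Type u) [CommRing K] (d : I → ℤ) : Submodule K (TSeries K I) :=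
  closedSpan {h | ∃ f g : TSeries K I, h = bracket d f g}

/-- Associative noncommutative 0-forms, `DR⁰(T̂W) = T̂W / [T̂W, T̂W]`. -/
abbrev AssZeroForms (K : Type u) [CommRing K] (d : I → ℤ) := TSeries K I ⧸ commutators K d

/-- The power series with vanishing constant term. -/
def augIdeal (K : Type u) [CommRing K] (I : Type v) : Submodule K (TSeries K I) where
  carrier := {f | f [] = 0}
  add_mem' {f g} hf hg := by
    change f [] + g [] = 0
    rw [show f [] = 0 from hf, show g [] = 0 from hg, add_zero]
  zero_mem' := rfl
  smul_mem' a f hf := by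
    change a * f [] = 0
    rw [show f [] = 0 from hf, mul_zero]

/-- The associative 0-forms vanishing at zero. -/
def vanishing (K : Type u) [CommRing K] (d : I → ℤ) : Submodule K (AssZeroForms K d) :=
  (augIdeal K I).map (commutators K d).mkQ

/-- The module `L̂W ⊗ L̂W`, as a closed submodule of `T̂W ⊗ T̂W`. -/
def lieTensor (K : Type u) [CommRing K] (d : I → ℤ) : Submodule K (Pro K (List I × List I)) :=
  closedSpan {F | ∃ x ∈ lieSeries K d, ∃ y ∈ lieSeries K d, F = tmul x y}

/-- The relations `x ⊗ y = (-1)^{|x||y|} y ⊗ x` and `x ⊗ [y, z] = [x, y] ⊗ z`. -/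
def lieRelations (K : Type u) [CommRing K] (d : I → ℤ) : Submodule K (Pro K (List I × List I)) :=
  closedSpan ({F | ∃ x ∈ lieSeries K d, ∃ y ∈ lieSeries K d, F = tmul x y - swap d (tmul x y)} ∪
    {F | ∃ x ∈ lieSeries K d, ∃ y ∈ lieSeries K d, ∃ z ∈ lieSeries K d,
      F = tmul x (bracket d y z) - tmul (bracket d x y) z})

/-- Lie 0-forms, `DR⁰(L̂W) = (L̂W ⊗ L̂W) / (x ⊗ y = (-1)^{|x||y|} y ⊗ x, x ⊗ [y, z] = [x, y] ⊗ z)`. -/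
abbrev LieZeroForms (K : Type u) [CommRing K] (d : I → ℤ) :=
  lieTensor K d ⧸ (lieRelations K d).submoduleOf (lieTensor K d)

theorem mu_mem_augIdeal {d : I → ℤ} {F : Pro K (List I × List I)} (hF : F ∈ lieTensor K d) :
    mu F ∈ augIdeal K I := by
  have hcl : IsClosed (augIdeal K I : Set (TSeries K I)) := by
    letI : TopologicalSpace K := ⊥
    haveI : DiscreteTopology K := ⟨rfl⟩
    exact (isClosed_discrete ({0} : Set K)).preimage (continuous_coord [])
  refine map_closedSpan mu hcl ?_ F hF
  rintro _ ⟨x, hx, y, hy, rfl⟩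
  change mu _ [] = 0
  rw [mu_nil, tmul_apply, nil_of_mem_lieSeries hx, zero_mul]

theorem mu_mem_commutators {d : I → ℤ} {F : Pro K (List I × List I)}
    (hF : F ∈ lieRelations K d) : mu F ∈ commutators K d := by
  refine map_closedSpan mu (isClosed_closedSpan _) ?_ F hF
  rintro _ (⟨x, hx, y, hy, rfl⟩ | ⟨x, hx, y, hy, z, hz, rfl⟩)
  · rw [map_sub]
    exact subset_closedSpan _ ⟨x, y, rfl⟩
  · rw [map_sub]
    change mulR x (bracketR d y z) - mulL z (bracketR d x y) ∈ commutators K d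
    have h1 : ∀ u v w : List I, (mulR (single u)).comp (bracketR d (single v)) (single w) -
        mulL (single w) (bracketR d (single u) (single v)) ∈ commutators K d := by
      intro u v w
      have : (mulR (single u)).comp (bracketR d (single v)) (single w) -
          mulL (single w) (bracketR d (single u) (single v)) =
          sg K (wdeg d u * wdeg d v) • bracket d (single v) (single (u ++ w) : TSeries K I) := by
        simp only [ContinuousLinearMap.comp_apply, bracketR_apply, bracket_single, map_sub, map_smul,
          mulR_apply, mulL_apply, mul_single, wdeg_append, smul_sub, smul_smul, mul_add, sg_add,
          List.append_assoc]
        rw [mul_comm (wdeg d v) (wdeg d u), ← mul_assoc, sg_mul_self, one_mul]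
        abel
      rw [this]
      exact Submodule.smul_mem _ _ (subset_closedSpan _ ⟨_, _, rfl⟩)
    have h2 : ∀ (u v : List I) (z : TSeries K I), mulR (single u) (bracketR d (single v) z) -
        mulR (bracketR d (single u) (single v)) z ∈ commutators K d := fun u v z =>
      mem_of_single ((mulR (single u)).comp (bracketR d (single v)) -
        mulR (bracketR d (single u) (single v))) (isClosed_closedSpan _) (fun w => h1 u v w) z
    have h3 : ∀ (u : List I) (y z : TSeries K I), mulR (single u) (bracketL d z y) -
        mulL z (bracketR d (single u) y) ∈ commutators K d := fun u y z =>
      mem_of_single ((mulR (single u)).comp (bracketL d z) -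
        (mulL z).comp (bracketR d (single u))) (isClosed_closedSpan _) (fun v => h2 u v z) y
    exact mem_of_single (mulL (bracket d y z) -
        (mulL z).comp (bracketL d y)) (isClosed_closedSpan _) (fun u => h3 u y z) x

variable {𝒦 : ℤ → AddSubgroup K} [GradedRing 𝒦] [EvenlyGraded 𝒦] {d : I → ℤ}
  (Q : HomologicalLieField 𝒦 d)

namespace HomologicalLieField

theorem extend_mem_commutators {f : TSeries K I} (hf : f ∈ commutators K d) :
    Q.extend f ∈ commutators K d := by
  refine map_closedSpan Q.extend (isClosed_closedSpan _) ?_ f hf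
  rintro _ ⟨f, g, rfl⟩
  rw [extend_bracket]
  exact add_mem (subset_closedSpan _ ⟨_, _, rfl⟩) (subset_closedSpan _ ⟨_, _, rfl⟩)

theorem tensorOp_mem_lieTensor {F : Pro K (List I × List I)} (hF : F ∈ lieTensor K d) :
    Q.tensorOp F ∈ lieTensor K d := by
  refine map_closedSpan Q.tensorOp (isClosed_closedSpan _) ?_ F hF
  rintro _ ⟨x, hx, y, hy, rfl⟩
  rw [tensorOp_tmul]
  exact add_mem (subset_closedSpan _ ⟨_, Q.extend_mem_lie hx, _, hy, rfl⟩)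
    (subset_closedSpan _ ⟨_, twist_mem_lieSeries 1 hx, _, Q.extend_mem_lie hy, rfl⟩)

theorem tensorOp_mem_lieRelations {F : Pro K (List I × List I)} (hF : F ∈ lieRelations K d) :
    Q.tensorOp F ∈ lieRelations K d := by
  refine map_closedSpan Q.tensorOp (isClosed_closedSpan _) ?_ F hF
  rintro _ (⟨x, hx, y, hy, rfl⟩ | ⟨x, hx, y, hy, z, hz, rfl⟩)
  · rw [map_sub, tensorOp_swap, tensorOp_tmul, map_add, add_sub_add_comm]
    exact add_mem (subset_closedSpan _ (Or.inl ⟨_, Q.extend_mem_lie hx, _, hy, rfl⟩))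
      (subset_closedSpan _ (Or.inl ⟨_, twist_mem_lieSeries 1 hx, _, Q.extend_mem_lie hy, rfl⟩))
  · have key : Q.tensorOp (tmul x (bracket d y z) - tmul (bracket d x y) z) =
        (tmul (Q.extend x) (bracket d y z) - tmul (bracket d (Q.extend x) y) z) +
        (tmul (twist d 1 x) (bracket d (Q.extend y) z) -
          tmul (bracket d (twist d 1 x) (Q.extend y)) z) +
        (tmul (twist d 1 x) (bracket d (twist d 1 y) (Q.extend z)) -
          tmul (bracket d (twist d 1 x) (twist d 1 y)) (Q.extend z)) := by
      rw [map_sub, tensorOp_tmul, tensorOp_tmul, extend_bracket, extend_bracket, twist_bracket,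
        ← tmulR_apply (twist d 1 x) (_ + _), map_add, ← tmulL_apply (_ + _) z, map_add]
      simp only [tmulR_apply, tmulL_apply]
      abel
    rw [key]
    refine add_mem (add_mem ?_ ?_) ?_
    · exact subset_closedSpan _ (Or.inr ⟨_, Q.extend_mem_lie hx, _, hy, _, hz, rfl⟩)
    · exact subset_closedSpan _ (Or.inr ⟨_, twist_mem_lieSeries 1 hx, _, Q.extend_mem_lie hy, _, hz,
        rfl⟩)
    · exact subset_closedSpan _ (Or.inr ⟨_, twist_mem_lieSeries 1 hx, _, twist_mem_lieSeries 1 hy, _,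
        Q.extend_mem_lie hz, rfl⟩)

/-- The Lie derivative `L_m` on associative 0-forms. -/
def assLieDeriv : AssZeroForms K d →L[K] AssZeroForms K d :=
  (commutators K d).liftQL ((commutators K d).mkQL.comp Q.extend) fun f hf => by
    change Submodule.Quotient.mk (Q.extend f) = (0 : AssZeroForms K d)
    exact (Submodule.Quotient.mk_eq_zero _).2 (Q.extend_mem_commutators hf)

theorem assLieDeriv_mk (f : TSeries K I) :
    Q.assLieDeriv (Submodule.Quotient.mk f) = Submodule.Quotient.mk (Q.extend f) := rfl

theorem assLieDeriv_mem (q : AssZeroForms K d) : Q.assLieDeriv q ∈ vanishing K d := by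
  induction q using Submodule.Quotient.induction_on with
  | _ f => exact ⟨Q.extend f, Q.extend_nil_eq_zero f, rfl⟩

/-- The cyclic Hochschild complex: the suspension of the associative 0-forms vanishing at zero, with
the Lie derivative as differential. The suspension is `(ΣX)ⁿ = Xⁿ⁺¹`. -/
def cyclicHochschild : TopComplex.{u, max u v} K where
  carrier := vanishing K d
  gr n := ((homog 𝒦 (wdeg d) (n + 1)).map (commutators K d).mkQ.toAddMonoidHom).comap
    (vanishing K d).subtype.toAddMonoidHom
  d := (Q.assLieDeriv.comp (vanishing K d).subtypeL).codRestrict (vanishing K d)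
    fun q => Q.assLieDeriv_mem q
  d_mem := by
    rintro n ⟨q, hq⟩ ⟨f, hf, rfl⟩
    exact ⟨Q.extend f, Q.extend_mem hf, rfl⟩
  d_d := by
    rintro ⟨q, hq⟩
    obtain ⟨f, hf, rfl⟩ := hq
    refine Subtype.ext ?_
    change (Submodule.Quotient.mk (Q.extend (Q.extend f)) : AssZeroForms K d) = 0
    rw [extend_extend]; rfl

/-- The operator `m ⊗ 1 + 1 ⊗ m` on `L̂W ⊗ L̂W`. -/
def lieTensorOp : lieTensor K d →L[K] lieTensor K d :=
  (Q.tensorOp.comp (lieTensor K d).subtypeL).codRestrict (lieTensor K d)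
    fun F => Q.tensorOp_mem_lieTensor F.2

/-- The Lie derivative `L_m` on Lie 0-forms,
`L_m(x ⊗ y) = m(x) ⊗ y + (-1)^{|x|} x ⊗ m(y)`. -/
def lieLieDeriv : LieZeroForms K d →L[K] LieZeroForms K d :=
  ((lieRelations K d).submoduleOf (lieTensor K d)).liftQL
    (((lieRelations K d).submoduleOf (lieTensor K d)).mkQL.comp Q.lieTensorOp) fun F hF => by
      change Submodule.Quotient.mk (Q.lieTensorOp F) = (0 : LieZeroForms K d)
      exact (Submodule.Quotient.mk_eq_zero _).2 (Q.tensorOp_mem_lieRelations hF)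

/-- The cyclic Harrison complex: the suspension of the Lie 0-forms, with the Lie derivative as
differential. -/
def cyclicHarrison : TopComplex.{u, max u v} K where
  carrier := LieZeroForms K d
  gr n := ((homog 𝒦 (fun p : List I × List I => wdeg d p.1 + wdeg d p.2) (n + 1)).comap
      (lieTensor K d).subtype.toAddMonoidHom).map
    ((lieRelations K d).submoduleOf (lieTensor K d)).mkQ.toAddMonoidHom
  d := Q.lieLieDeriv
  d_mem := by
    rintro n _ ⟨F, hF, rfl⟩
    exact ⟨Q.lieTensorOp F, Q.tensorOp_homog hF, rfl⟩
  d_d x := by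
    induction x using Submodule.Quotient.induction_on with
    | _ F =>
      change (Submodule.Quotient.mk (Q.lieTensorOp (Q.lieTensorOp F)) : LieZeroForms K d) = 0
      have : Q.lieTensorOp (Q.lieTensorOp F) = 0 := Subtype.ext (Q.tensorOp_tensorOp F)
      rw [this]; rfl

/-- The map `l` from the cyclic Harrison complex to the cyclic Hochschild complex, induced by
`x ⊗ y ↦ x y`. -/
def lieToAss : Q.cyclicHarrison →L[K] Q.cyclicHochschild :=
  ((lieRelations K d).submoduleOf (lieTensor K d)).liftQL
    (((commutators K d).mkQL.comp (mu.comp (lieTensor K d).subtypeL)).codRestrict (vanishing K d)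
      fun F => ⟨mu F.1, mu_mem_augIdeal F.2, rfl⟩) fun F hF => by
        refine LinearMap.mem_ker.2 (Subtype.ext ?_)
        change Submodule.Quotient.mk (mu F.1) = (0 : AssZeroForms K d)
        exact (Submodule.Quotient.mk_eq_zero _).2 (mu_mem_commutators hF)

end HomologicalLieField

/-! ### The Hodge decomposition -/

/-- The coefficients of the shuffle coproduct: `comulFun d f u v` is the coefficient at `u ⊗ v` of
`Δ f`, where `Δ` is the continuous algebra homomorphism with `Δ(tᵢ) = tᵢ ⊗ 1 + 1 ⊗ tᵢ` and the
multiplication on `T̂W ⊗ T̂W` obeys the Koszul rule. -/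
def comulFun (d : I → ℤ) : TSeries K I → List I → List I → K
  | f, [], v => f v
  | f, a :: u, [] => f (a :: u)
  | f, a :: u, b :: v =>
    comulFun d (pull (fun w => a :: w) f) u (b :: v) +
      sg K (d b * wdeg d (a :: u)) * comulFun d (pull (fun w => b :: w) f) (a :: u) v
termination_by _ u v => u.length + v.length

theorem comulFun_add (d : I → ℤ) : ∀ (f g : TSeries K I) (u v : List I),
    comulFun d (f + g) u v = comulFun d f u v + comulFun d g u v
  | f, g, [], v => by simp [comulFun]
  | f, g, a :: u, [] => by simp [comulFun]
  | f, g, a :: u, b :: v => by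
    rw [comulFun, comulFun, comulFun, map_add, map_add, comulFun_add, comulFun_add]
    ring
termination_by _ _ u v => u.length + v.length

theorem comulFun_smul (d : I → ℤ) (c : K) : ∀ (f : TSeries K I) (u v : List I),
    comulFun d (c • f) u v = c * comulFun d f u v
  | f, [], v => by simp [comulFun]
  | f, a :: u, [] => by simp [comulFun]
  | f, a :: u, b :: v => by
    rw [comulFun, comulFun, map_smul, map_smul, comulFun_smul, comulFun_smul]
    ring
termination_by _ u v => u.length + v.length

/-- The shuffle coproduct `Δ : T̂W → T̂W ⊗ T̂W`. -/
def comul (d : I → ℤ) : TSeries K I →ₗ[K] Pro K (List I × List I) where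
  toFun f := fun p => comulFun d f p.1 p.2
  map_add' f g := by
    funext p
    exact comulFun_add d f g p.1 p.2
  map_smul' c f := by
    funext p
    exact comulFun_smul d c f p.1 p.2

/-- The modified shuffle operator `s = μ Δ`. -/
def shuffleOp (d : I → ℤ) : Module.End K (TSeries K I) := mu.toLinearMap ∘ₗ comul d

/-- The operator `e_n(j)`: for `j ≤ n` the Lagrange interpolation polynomial of `s` for the nodes
`2^0, …, 2^n` (with value `1` at `2^j` and value `0` at the other nodes), and zero for `j > n`. -/
def hodgeComp [Algebra ℚ K] (d : I → ℤ) (n j : ℕ) : Module.End K (TSeries K I) :=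
  if j ≤ n then
    Polynomial.aeval (shuffleOp d : Module.End K (TSeries K I))
      ((Lagrange.basis (Finset.range (n + 1)) (fun r : ℕ => (2 : ℚ) ^ r) j).map (algebraMap ℚ K))
  else 0

/-- The operator `e(j)` on `T̂W`, equal to `e_n(j)` on series of order `n`. As `s` preserves the
order, the coefficient of `e(j) f` at a word of length `n` is the one of `e_n(j) f`. -/
def hodgeIdem [Algebra ℚ K] (d : I → ℤ) (j : ℕ) : Module.End K (TSeries K I) where
  toFun f := fun w => hodgeComp d w.length j f w
  map_add' f g := by
    funext w
    change hodgeComp d w.length j (f + g) w =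
      hodgeComp d w.length j f w + hodgeComp d w.length j g w
    rw [map_add]; rfl
  map_smul' c f := by
    funext w
    change hodgeComp d w.length j (c • f) w = c * hodgeComp d w.length j f w
    rw [map_smul]; rfl

/-- The `j`-th Hodge summand of the cyclic Hochschild complex: the image of `e(j + 1)` in the
associative 0-forms (vanishing at zero). -/
def HomologicalLieField.hodgeSummand [Algebra ℚ K] (j : ℕ) : Submodule K Q.cyclicHochschild :=
  ((LinearMap.range (hodgeIdem (K := K) d (j + 1))).map (commutators K d).mkQ).comap
    (vanishing K d).subtype

end Cyclic

/-- A `C_∞`-structure on the free graded `K`-module `V` with a homogeneous basis `xᵢ`, `i ∈ I`, of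
degrees `deg i`. It is a homological vector field on `L̂(ΣV*)`, and the topological basis `tᵢ` of
`ΣV*` dual to `Σxᵢ` has degrees `1 - deg i`, as `(ΣV)ⁿ = Vⁿ⁺¹`. -/
abbrev CInfinityStructure {K : Type*} [CommRing K] {I : Type*} (𝒦 : ℤ → AddSubgroup K)
    (deg : I → ℤ) := HomologicalLieField 𝒦 fun i => 1 - deg i

end FormalNC

end

/-!
The map `l : x ⊗ y ↦ x y` from `L̂W ⊗ L̂W` modulo the relations of Lie 0-forms to `T̂W` modulo
commutators is inverted, on the image of `e(2)`, by the normalised cyclic derivative `D`. It sends a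
word of length `n` to `1/n` times the sum of its cyclic rotations, each of them split after its
first letter.

* `D` kills commutators, and `μ D` is the identity modulo commutators on series without constant
  term, since a word is congruent to each of its rotations (`mu_normCycDeriv_sub_mem`).
* `D μ` is the identity on `L̂W ⊗ L̂W` modulo the relations (`normCycDeriv_mu_sub_mem`). For Lie
  monomials `y` and `x`, the sum `rot (y ⊗ x)` of the rotations of `y x` which begin in `y` satisfies
  `rot ([y, z] ⊗ x) = rot (y ⊗ [z, x]) ± rot (z ⊗ [x, y])`, and the invariance of `⊗` under the
  bracket gives `rot (y ⊗ x) = |y| y ⊗ x` modulo relations, `|y|` being the length of the words of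
  `y`. Hence `l` is injective.

The image of `l` is the image of `e(2)`. Lie series being primitive, the shuffle operator `s` acts on
products of `n` Lie monomials as `2 ^ n`, up to products of fewer of them
(`IsLieProduct.shuffleOp_sub_mem`). A word of length `n` is such a product, so the polynomial with the
roots `2 ^ 0, …, 2 ^ n` in `s` annihilates it, and `e(2)` maps it to an eigenvector of `s` for the
eigenvalue `4`. Such a vector is a combination of products of at most two Lie series, which is a sum
of products of exactly two modulo commutators (`exists_hodgeL_single_sub_mem`). Conversely,
`x y ± y x` is an eigenvector for the eigenvalue `4` and congruent to `2 x y`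
(`hodgeL_mu_sub_mem`).

A derivation of `T̂W` which maps `W` to `L̂W` is a coderivation, so that it commutes with `s`
(`IsDeriv.shuffleOp_apply`). For the adjoint action of `W`, this shows that `e(2)` preserves
commutators; for the vector field `m`, that `e(2)` is a map of complexes. The retraction of `l` is
therefore `f ↦ D(e(2) f)`: it is a map of complexes because `l` is injective and its composite with
the retraction is induced by `e(2)`.
-/

noncomputable section

open Topology Filter

namespace FormalNC

/-! ### Continuous maps of profinite modules -/

section Pro

variable {K : Type*} [CommRing K] {X Y Z M : Type*}

open Pro

/-- The continuous linear map with prescribed values `A x` on the topological basis. Every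
coordinate may occur in finitely many of the `A x` only, so that the infinite linear combinations
of the `A x` converge. -/
def Pro.ofBasis (A : X → Pro K Y) (hA : ∀ y, {x | A x y ≠ 0}.Finite) : Pro K X →L[K] Pro K Y where
  toFun f := fun y => ∑ x ∈ (hA y).toFinset, f x * A x y
  map_add' f g := by
    funext y
    simp only [Pro.add_apply, add_mul]
    exact Finset.sum_add_distrib
  map_smul' c f := by
    funext y
    simp only [Pro.smul_apply, mul_assoc]
    exact (Finset.mul_sum _ _ _).symm
  cont := by
    let _ : TopologicalSpace K := ⊥
    have : DiscreteTopology K := ⟨rfl⟩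
    exact continuous_of_coord fun y => continuous_finsetSum _ fun x _ =>
      (continuous_coord x).mul_const _

theorem Pro.ofBasis_apply (A : X → Pro K Y) (hA : ∀ y, {x | A x y ≠ 0}.Finite) (f : Pro K X)
    (y : Y) : ofBasis A hA f y = ∑ x ∈ (hA y).toFinset, f x * A x y := rfl

theorem Pro.ofBasis_single (A : X → Pro K Y) (hA : ∀ y, {x | A x y ≠ 0}.Finite) (x : X) :
    ofBasis A hA (single x) = A x := by
  classical
  funext y
  rw [ofBasis_apply]
  by_cases h : A x y = 0
  · rw [h]
    refine Finset.sum_eq_zero fun z _ => ?_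
    by_cases hz : z = x
    · rw [hz, h, mul_zero]
    · simp [single, hz]
  · rw [Finset.sum_eq_single x]
    · simp [single]
    · intro z _ hz
      simp [single, hz]
    · intro hx
      exact absurd ((hA y).mem_toFinset.2 h) hx

theorem Pro.single_apply_self (x : X) : (single x : Pro K X) x = 1 := by simp [single]

theorem Pro.single_apply_ne {x y : X} (h : y ≠ x) : (single x : Pro K X) y = 0 := by
  simp [single, h]

theorem Pro.diag_single (c : X → K) (x : X) : diag c (single x) = c x • (single x : Pro K X) := by
  funext y
  by_cases h : y = x
  · subst h; simp
  · simp [single_apply_ne h]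

/-- `f` is homogeneous of weight `p` for the weight function `δ` on the topological basis. -/
def SuppOn (δ : X → M) (p : M) (f : Pro K X) : Prop := ∀ x, δ x ≠ p → f x = 0

theorem suppOn_single (δ : X → M) (x : X) : SuppOn δ (δ x) (single x : Pro K X) :=
  fun _ hy => single_apply_ne fun h => hy (by rw [h])

theorem SuppOn.add {δ : X → M} {p : M} {f g : Pro K X} (hf : SuppOn δ p f) (hg : SuppOn δ p g) :
    SuppOn δ p (f + g) := fun x hx => by simp [hf x hx, hg x hx]

theorem SuppOn.sub {δ : X → M} {p : M} {f g : Pro K X} (hf : SuppOn δ p f) (hg : SuppOn δ p g) :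
    SuppOn δ p (f - g) := fun x hx => by simp [hf x hx, hg x hx]

theorem SuppOn.smul {δ : X → M} {p : M} {f : Pro K X} (c : K) (hf : SuppOn δ p f) :
    SuppOn δ p (c • f) := fun x hx => by simp [hf x hx]

theorem SuppOn.diag_eq {δ : X → M} {p : M} {f : Pro K X} (hf : SuppOn δ p f) {c : X → K} {a : K}
    (hc : ∀ x, δ x = p → c x = a) : diag c f = a • f := by
  funext x
  by_cases h : δ x = p
  · simp [hc x h]
  · simp [hf x h]

/-- For a homogeneous `f`, it suffices to know a continuous map on the basis elements of the same
weight. -/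
theorem SuppOn.map_mem {δ : X → M} {p : M} {f : Pro K X} (hf : SuppOn δ p f)
    (A : Pro K X →L[K] Pro K Y) {T : Submodule K (Pro K Y)} (hT : IsClosed (T : Set (Pro K Y)))
    (h : ∀ x, δ x = p → A (single x) ∈ T) : A f ∈ T := by
  classical
  have h1 : diag (fun x => if δ x = p then (1 : K) else 0) f = f := by
    rw [hf.diag_eq (a := 1) fun x hx => by simp [hx], one_smul]
  rw [← h1]
  refine mem_of_single (A.comp (diag fun x => if δ x = p then (1 : K) else 0)) hT (fun x => ?_) f
  rw [ContinuousLinearMap.comp_apply, diag_single, map_smul]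
  by_cases hx : δ x = p
  · exact T.smul_mem _ (h x hx)
  · simp [hx]

theorem SuppOn.map_eq {δ : X → M} {p : M} {f : Pro K X} (hf : SuppOn δ p f)
    {A B : Pro K X →L[K] Pro K Y} (h : ∀ x, δ x = p → A (single x) = B (single x)) :
    A f = B f := by
  have := hf.map_mem (A - B) (T := ⊥) (by simp) (by simpa [sub_eq_zero] using h)
  simpa [sub_eq_zero] using this

end Pro

section Tensor

variable {K : Type*} [CommRing K] {I : Type*} {M : Type*}

open Pro

theorem sg_congr {m n : ℤ} (h : ∃ k, m = n + 2 * k) : sg K m = sg K n := by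
  obtain ⟨k, rfl⟩ := h
  rw [sg_add, sg_even (even_two_mul k), mul_one]

theorem SuppOn.twist_eq {d : I → ℤ} {p : ℤ} {f : TSeries K I} (hf : SuppOn (wdeg d) p f) (k : ℤ) :
    twist d k f = sg K (k * p) • f := twist_of_supp hf k

theorem SuppOn.mul [Add M] {γ : List I → M} (hγ : ∀ u v, γ (u ++ v) = γ u + γ v) {p q : M}
    {f g : TSeries K I} (hf : SuppOn γ p f) (hg : SuppOn γ q g) :
    SuppOn γ (p + q) (FormalNC.mul f g) := by
  intro w hw
  rw [FormalNC.mul, mu_apply]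
  refine Finset.sum_eq_zero fun k _ => ?_
  rw [tmul_apply]
  by_cases h1 : γ (w.take k) = p
  · by_cases h2 : γ (w.drop k) = q
    · refine absurd ?_ hw
      conv_lhs => rw [← List.take_append_drop k w]
      rw [hγ, h1, h2]
    · rw [hg _ h2, mul_zero]
  · rw [hf _ h1, zero_mul]

theorem one_mul' (f : TSeries K I) : mul (single []) f = f := by
  have : (mulR (single []) : TSeries K I →L[K] _) = ContinuousLinearMap.id K _ :=
    hom_ext fun x => by simp [mul_single]
  exact congrArg (· f) this

theorem mul_one' (f : TSeries K I) : mul f (single []) = f := by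
  have : (mulL (single []) : TSeries K I →L[K] _) = ContinuousLinearMap.id K _ :=
    hom_ext fun x => by simp [mul_single]
  exact congrArg (· f) this

theorem sub_mul' (f g h : TSeries K I) : mul (f - g) h = mul f h - mul g h := map_sub (mulL h) f g

theorem mul_sub' (f g h : TSeries K I) : mul f (g - h) = mul f g - mul f h := map_sub (mulR f) g h

theorem swap_tmul_of_suppOn {d : I → ℤ} {p q : ℤ} {f g : TSeries K I}
    (hf : SuppOn (wdeg d) p f) (hg : SuppOn (wdeg d) q g) :
    swap d (tmul f g) = sg K (p * q) • tmul g f := by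
  funext x
  rw [swap_apply, tmul_apply, Pro.smul_apply, tmul_apply]
  by_cases h1 : wdeg d x.2 = p
  · by_cases h2 : wdeg d x.1 = q
    · rw [h1, h2, mul_comm q p, mul_comm (f _)]
    · rw [hg _ h2]; ring
  · rw [hf _ h1]; ring

theorem bracket_of_suppOn {d : I → ℤ} {p q : ℤ} {f g : TSeries K I}
    (hf : SuppOn (wdeg d) p f) (hg : SuppOn (wdeg d) q g) :
    bracket d f g = mul f g - sg K (p * q) • mul g f := by
  rw [bracket, swap_tmul_of_suppOn hf hg, map_smul]; rfl

theorem bracket_single_right (d : I → ℤ) (f : TSeries K I) (v : List I) :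
    bracket d f (single v) = mul f (single v) - mul (single v) (twist d (wdeg d v) f) := by
  rw [bracket, swap_tmul_single]; rfl

theorem SuppOn.bracket {d : I → ℤ} {p q : ℤ} {f g : TSeries K I}
    (hf : SuppOn (wdeg d) p f) (hg : SuppOn (wdeg d) q g) :
    SuppOn (wdeg d) (p + q) (FormalNC.bracket d f g) := by
  rw [bracket_of_suppOn hf hg]
  refine (hf.mul (wdeg_append d) hg).sub (SuppOn.smul _ ?_)
  rw [add_comm]
  exact hg.mul (wdeg_append d) hf

theorem SuppOn.bracket_length {d : I → ℤ} {p q : ℤ} {j k : ℕ} {f g : TSeries K I}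
    (hf : SuppOn (wdeg d) p f) (hg : SuppOn (wdeg d) q g)
    (hf' : SuppOn List.length j f) (hg' : SuppOn List.length k g) :
    SuppOn List.length (j + k) (FormalNC.bracket d f g) := by
  rw [bracket_of_suppOn hf hg]
  refine (hf'.mul (fun _ _ => List.length_append) hg').sub (SuppOn.smul _ ?_)
  rw [add_comm]
  exact hg'.mul (fun _ _ => List.length_append) hf'

/-- Lie monomials are homogeneous both for the degree and for the length of words. -/
theorem IsLieMonomial.exists_suppOn {d : I → ℤ} {f : TSeries K I} (hf : IsLieMonomial d f) :
    ∃ p k, k ≠ 0 ∧ SuppOn (wdeg d) p f ∧ SuppOn List.length k f := by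
  induction hf with
  | gen i =>
    exact ⟨_, 1, one_ne_zero, suppOn_single (wdeg d) [i], suppOn_single List.length [i]⟩
  | bracket f g _ _ ihf ihg =>
    obtain ⟨p, j, hj, hf, hf'⟩ := ihf
    obtain ⟨q, k, hk, hg, hg'⟩ := ihg
    exact ⟨p + q, j + k, by omega, hf.bracket hg, hf.bracket_length hg hf' hg'⟩

theorem IsLieMonomial.mem {d : I → ℤ} {f : TSeries K I} (hf : IsLieMonomial d f) :
    f ∈ lieSeries K d := subset_closedSpan _ hf

/-- A continuous map sends `L̂W ⊗ L̂W` to a closed submodule as soon as it does so for the tensor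
products of Lie monomials. -/
theorem lieTensor_map_mem {d : I → ℤ} {Y : Type*} (A : Pro K (List I × List I) →L[K] Pro K Y)
    {T : Submodule K (Pro K Y)} (hT : IsClosed (T : Set (Pro K Y)))
    (h : ∀ x y : TSeries K I, IsLieMonomial d x → IsLieMonomial d y → A (tmul x y) ∈ T)
    {F : Pro K (List I × List I)} (hF : F ∈ lieTensor K d) : A F ∈ T := by
  refine map_closedSpan A hT ?_ F hF
  rintro _ ⟨x, hx, y, hy, rfl⟩
  refine map_closedSpan (A.comp (tmulL y)) hT (fun x hx => ?_) x hx
  exact map_closedSpan (A.comp (tmulR x)) hT (fun y hy => h x y hx hy) y hy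

end Tensor

/-! ### Cyclic derivatives -/

section Cyclic

variable {K : Type*} [CommRing K] {I : Type*}

open Pro

/-- For words `y` and `x`, the sum `∑ ± a ⊗ v x u` over the factorisations `y = u a v` with a letter
`a`; the summand is the cyclic rotation of `y x` which begins with `a`, split after `a`, and the
sign is the Koszul sign of that rotation. -/
def rotWord (d : I → ℤ) : List I → List I → Pro K (List I × List I)
  | [], _ => 0
  | a :: y, x => single ([a], y ++ x) + sg K (d a * (wdeg d y + wdeg d x)) • rotWord d y (x ++ [a])

theorem rotWord_append (d : I → ℤ) (y z x : List I) :
    (rotWord d (y ++ z) x : Pro K _) = rotWord d y (z ++ x) +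
      sg K (wdeg d y * (wdeg d z + wdeg d x)) • rotWord d z (x ++ y) := by
  induction y generalizing x with
  | nil => simp [rotWord]
  | cons a y ih =>
    simp only [List.cons_append, rotWord, ih, smul_add, smul_smul, wdeg_append, wdeg_cons, wdeg_nil,
      ← sg_add, List.append_assoc, List.nil_append]
    refine (add_assoc _ _ _).symm.trans ?_
    rw [add_assoc (wdeg d y)]
    congr 2
    exact sg_congr ⟨d a * wdeg d y, by ring⟩

theorem rotWord_perm (d : I → ℤ) (y x : List I) (p : List I × List I)
    (h : (rotWord d y x : Pro K (List I × List I)) p ≠ 0) : (y ++ x).Perm (p.1 ++ p.2) := by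
  induction y generalizing x with
  | nil => exact absurd rfl h
  | cons a y ih =>
    by_cases hp : p = ([a], y ++ x)
    · subst hp; exact List.Perm.refl _
    · rw [rotWord, Pro.add_apply, single_apply_ne hp, zero_add, Pro.smul_apply] at h
      refine List.Perm.trans ?_ (ih _ (right_ne_zero_of_mul h))
      rw [← List.append_assoc]
      exact (List.perm_append_singleton a (y ++ x)).symm

/-- The rotations of `y x` are among the finitely many permutations of its letters. -/
theorem finite_rotWord (d : I → ℤ) (p : List I × List I) :
    {q : List I × List I | (rotWord d q.1 q.2 : Pro K _) p ≠ 0}.Finite := by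
  classical
  let S : Finset (List I) := (p.1 ++ p.2).permutations.toFinset
  refine Set.Finite.subset (S.biUnion fun w => (Finset.range (w.length + 1)).image
    fun k => (w.take k, w.drop k)).finite_toSet ?_
  rintro ⟨y, x⟩ h
  have h1 : (y ++ x).Perm (p.1 ++ p.2) := rotWord_perm d y x p h
  simp only [Finset.coe_biUnion, Set.mem_iUnion, Finset.coe_image, Set.mem_image]
  refine ⟨y ++ x, by simpa [S] using h1, y.length, by simp, by simp⟩

/-- The continuous extension of `rotWord` to `T̂W ⊗ T̂W`. -/
def rot (d : I → ℤ) : Pro K (List I × List I) →L[K] Pro K (List I × List I) :=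
  ofBasis (fun q => rotWord d q.1 q.2) (finite_rotWord d)

theorem rot_single (d : I → ℤ) (y x : List I) :
    rot d (tmul (single y) (single x)) = (rotWord d y x : Pro K _) := by
  rw [← single_prod]; exact ofBasis_single _ _ (y, x)

theorem rot_gen (d : I → ℤ) (a : I) (x : TSeries K I) : rot d (tmul (gen a) x) = tmul (gen a) x := by
  have : (rot d).comp (tmulR (gen a)) = (tmulR (gen a) : TSeries K I →L[K] _) :=
    hom_ext fun x => by
      change rot d (tmul (single [a]) (single x)) = tmul (single [a]) (single x)
      rw [rot_single, ← single_prod]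
      simp [rotWord]
  exact congrArg (· x) this

/-- The rotations of `y z x` beginning in `y` or `z` are those of `y (z x)` beginning in `y` and
those of `z (x y)` beginning in `z`. -/
theorem rot_mul {d : I → ℤ} {p q r : ℤ} {y z x : TSeries K I} (hy : SuppOn (wdeg d) p y)
    (hz : SuppOn (wdeg d) q z) (hx : SuppOn (wdeg d) r x) :
    rot d (tmul (mul y z) x) =
      rot d (tmul y (mul z x)) + sg K (p * (q + r)) • rot d (tmul z (mul x y)) := by
  have h0 : ∀ y z x : List I, rot d (tmul (mul (single y) (single z)) (single x)) =
      (rot d (tmul (single y) (mul (single z) (single x))) +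
        sg K (wdeg d y * (wdeg d z + wdeg d x)) •
          rot d (tmul (single z) (mul (single x) (single y))) : Pro K _) := by
    intro y z x
    rw [mul_single, mul_single, mul_single, rot_single, rot_single, rot_single, rotWord_append]
  have h1 : ∀ y z : List I, wdeg d y = p → wdeg d z = q →
      rot d (tmul (mul (single y) (single z)) x) =
      rot d (tmul (single y) (mul (single z) x)) +
        sg K (p * (q + r)) • rot d (tmul (single z) (mul x (single y))) := by
    rintro y z rfl rfl
    refine hx.map_eq (A := (rot d).comp (tmulR (mul (single y) (single z))))
      (B := (rot d).comp ((tmulR (single y)).comp (mulR (single z))) +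
        sg K (wdeg d y * (wdeg d z + r)) •
          (rot d).comp ((tmulR (single z)).comp (mulL (single y)))) ?_
    rintro x rfl
    exact h0 y z x
  have h2 : ∀ y : List I, wdeg d y = p → rot d (tmul (mul (single y) z) x) =
      rot d (tmul (single y) (mul z x)) +
        sg K (p * (q + r)) • rot d (tmul z (mul x (single y))) := by
    intro y hy
    exact hz.map_eq (A := (rot d).comp ((tmulL x).comp (mulR (single y))))
      (B := (rot d).comp ((tmulR (single y)).comp (mulL x)) +
        sg K (p * (q + r)) • (rot d).comp (tmulL (mul x (single y)))) fun z hz => h1 y z hy hz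
  exact hy.map_eq (A := (rot d).comp ((tmulL x).comp (mulL z)))
    (B := (rot d).comp (tmulL (mul z x)) +
      sg K (p * (q + r)) • (rot d).comp ((tmulR z).comp (mulR x))) fun y hy => h2 y hy

theorem rot_bracket {d : I → ℤ} {p q r : ℤ} {y z x : TSeries K I} (hy : SuppOn (wdeg d) p y)
    (hz : SuppOn (wdeg d) q z) (hx : SuppOn (wdeg d) r x) :
    rot d (tmul (bracket d y z) x) = rot d (tmul y (bracket d z x)) +
      sg K (p * (q + r)) • rot d (tmul z (bracket d x y)) := by
  have e : rot d (tmul (bracket d y z) x) = rot d (tmul (mul y z) x) -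
      sg K (p * q) • rot d (tmul (mul z y) x) := by
    rw [bracket_of_suppOn hy hz, ← tmulL_apply, map_sub, map_smul, map_sub, map_smul]; rfl
  have e1 : rot d (tmul y (bracket d z x)) = rot d (tmul y (mul z x)) -
      sg K (q * r) • rot d (tmul y (mul x z)) := by
    rw [bracket_of_suppOn hz hx, ← tmulR_apply, map_sub, map_smul, map_sub, map_smul]; rfl
  have e2 : rot d (tmul z (bracket d x y)) = rot d (tmul z (mul x y)) -
      sg K (r * p) • rot d (tmul z (mul y x)) := by
    rw [bracket_of_suppOn hx hy, ← tmulR_apply, map_sub, map_smul, map_sub, map_smul]; rfl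
  rw [e, e1, e2, rot_mul hy hz hx, rot_mul hz hy hx, smul_add, smul_sub, smul_smul, smul_smul,
    ← sg_add, ← sg_add, sg_congr (K := K) (m := p * q + q * (p + r)) (n := q * r) ⟨p * q, by ring⟩,
    sg_congr (K := K) (m := p * (q + r) + r * p) (n := p * q) ⟨r * p, by ring⟩]
  abel

theorem lieRelations_symm {d : I → ℤ} {p q : ℤ} {x y : TSeries K I} (hx : x ∈ lieSeries K d)
    (hy : y ∈ lieSeries K d) (hx' : SuppOn (wdeg d) p x) (hy' : SuppOn (wdeg d) q y) :
    tmul x y - sg K (p * q) • tmul y x ∈ lieRelations K d := by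
  rw [← swap_tmul_of_suppOn hx' hy']
  exact subset_closedSpan _ (Or.inl ⟨x, hx, y, hy, rfl⟩)

theorem lieRelations_assoc {d : I → ℤ} {x y z : TSeries K I} (hx : x ∈ lieSeries K d)
    (hy : y ∈ lieSeries K d) (hz : z ∈ lieSeries K d) :
    tmul x (bracket d y z) - tmul (bracket d x y) z ∈ lieRelations K d :=
  subset_closedSpan _ (Or.inr ⟨x, hx, y, hy, z, hz, rfl⟩)

/-- Modulo the relations of Lie 0-forms, `rot` multiplies `y ⊗ x` by the length of `y`: by
`rot_bracket` and the relations, this property is inherited by brackets. -/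
theorem rot_sub_mem_lieRelations {d : I → ℤ} {y : TSeries K I} (hy : IsLieMonomial d y) :
    ∃ k : ℕ, SuppOn List.length k y ∧ ∀ x, IsLieMonomial d x →
      rot d (tmul y x) - (k : K) • tmul y x ∈ lieRelations K d := by
  induction hy with
  | gen a =>
    refine ⟨1, suppOn_single List.length [a], fun x _ => ?_⟩
    rw [rot_gen, Nat.cast_one, one_smul, sub_self]
    exact zero_mem _
  | bracket y z hy hz ihy ihz =>
    obtain ⟨j, hj, ihy⟩ := ihy
    obtain ⟨k, hk, ihz⟩ := ihz
    obtain ⟨p, -, -, hp, -⟩ := hy.exists_suppOn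
    obtain ⟨q, -, -, hq, -⟩ := hz.exists_suppOn
    refine ⟨j + k, hp.bracket_length hq hj hk, fun x hx => ?_⟩
    obtain ⟨r, -, -, hr, -⟩ := hx.exists_suppOn
    have h1 := ihy _ (IsLieMonomial.bracket z x hz hx)
    have h2 := Submodule.smul_mem _ (sg K (p * (q + r))) (ihz _ (IsLieMonomial.bracket x y hx hy))
    have h3 := Submodule.smul_mem _ ((j : K) + k) (lieRelations_assoc hy.mem hz.mem hx.mem)
    have h4 := Submodule.smul_mem _ ((k : K) * sg K (p * (q + r)))
      (lieRelations_assoc hz.mem hx.mem hy.mem)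
    have h5 := Submodule.smul_mem _ ((k : K) * sg K (p * (q + r)))
      (lieRelations_symm (bracket_mem d hz.mem hx.mem) hy.mem (hq.bracket hr) hp)
    have e : (k : K) * sg K (p * (q + r)) * sg K ((q + r) * p) = k := by
      rw [mul_comm (q + r) p, mul_assoc, sg_mul_self, mul_one]
    have key := add_mem (add_mem (add_mem (add_mem h1 h2) h3) h4) h5
    convert key using 1
    rw [rot_bracket hp hq hr]
    simp only [smul_sub, smul_smul, e, Nat.cast_add, mul_comm (sg K (p * (q + r))) (k : K), add_smul]
    abel

/-- The cyclic derivative `f ↦ ∑ᵢ tᵢ ⊗ ∂f/∂tᵢ`: a word is sent to the sum of its cyclic rotations,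
each of them split after its first letter. -/
def cycDeriv (d : I → ℤ) : TSeries K I →L[K] Pro K (List I × List I) :=
  (rot d).comp (tmulL (single []))

theorem cycDeriv_single (d : I → ℤ) (w : List I) :
    cycDeriv d (single w) = (rotWord d w [] : Pro K _) := rot_single d w []

theorem cycDeriv_mu (d : I → ℤ) (F : Pro K (List I × List I)) :
    cycDeriv d (mu F) = rot d F + rot d (swap d F) := by
  have : (cycDeriv d).comp mu = (rot d + (rot d).comp (swap d) : Pro K (List I × List I) →L[K] _) :=
    hom_ext fun p => by
      obtain ⟨y, x⟩ := p
      change cycDeriv d (mu (single (y, x) : Pro K (List I × List I))) = rot d (single (y, x)) +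
        rot d (swap d (single (y, x)))
      rw [single_prod, mu_single, cycDeriv_single,
        swap_tmul_of_suppOn (suppOn_single _ y) (suppOn_single _ x), map_smul, rot_single,
        rot_single, rotWord_append]
      simp
  exact congrArg (· F) this

theorem swap_swap (d : I → ℤ) (F : Pro K (List I × List I)) : swap d (swap d F) = F := by
  funext p
  rw [swap_apply, swap_apply, mul_comm (wdeg d p.2), ← mul_assoc, sg_mul_self, one_mul]

/-- The cyclic derivative kills commutators. -/
theorem cycDeriv_commutators {d : I → ℤ} {f : TSeries K I} (hf : f ∈ commutators K d) :
    cycDeriv d f = 0 := by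
  refine (Submodule.mem_bot K).1 (map_closedSpan (cycDeriv d) (T := ⊥) (by simp) ?_ f hf)
  rintro _ ⟨f, g, rfl⟩
  rw [Submodule.mem_bot, bracket, map_sub, cycDeriv_mu, cycDeriv_mu, swap_swap, add_comm, sub_self]

theorem mul_sub_mem_commutators {d : I → ℤ} {p q : ℤ} {f g : TSeries K I}
    (hf : SuppOn (wdeg d) p f) (hg : SuppOn (wdeg d) q g) :
    mul f g - sg K (p * q) • mul g f ∈ commutators K d := by
  rw [← bracket_of_suppOn hf hg]
  exact subset_closedSpan _ ⟨f, g, rfl⟩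

/-- All rotations of a word agree modulo commutators. -/
theorem mu_rotWord (d : I → ℤ) (y x : List I) :
    mu (rotWord d y x) - (y.length : K) • single (y ++ x) ∈ commutators K d := by
  induction y generalizing x with
  | nil => simp [rotWord]
  | cons a y ih =>
    have h1 := Submodule.smul_mem _ (sg K (d a * (wdeg d y + wdeg d x))) (ih (x ++ [a]))
    have h2 := Submodule.smul_mem _ (y.length : K)
      (mul_sub_mem_commutators (K := K) (suppOn_single (wdeg d) [a])
        (suppOn_single (wdeg d) (y ++ x)))
    have key := sub_mem h1 h2
    convert key using 1
    rw [rotWord, single_prod, map_add, mu_single, map_smul, mul_single, mul_single]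
    simp only [wdeg_append, wdeg_cons, wdeg_nil, add_zero, List.length_cons, Nat.cast_add,
      Nat.cast_one, add_smul, one_smul, smul_sub, smul_smul, List.cons_append, List.nil_append,
      List.append_assoc, mul_comm (y.length : K)]
    abel

theorem rotWord_length (d : I → ℤ) (w : List I) :
    SuppOn (fun p : List I × List I => p.1.length + p.2.length) w.length
      (rotWord d w [] : Pro K _) := by
  intro p hp
  by_contra h
  have := (rotWord_perm d w [] p h).length_eq
  rw [List.append_nil, List.length_append] at this
  exact hp this.symm

theorem rotWord_wdeg (d : I → ℤ) (y x : List I) :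
    SuppOn (fun p : List I × List I => wdeg d p.1 + wdeg d p.2) (wdeg d y + wdeg d x)
      (rotWord d y x : Pro K _) := by
  intro p hp
  by_contra h
  have := ((rotWord_perm d y x p h).map d).sum_eq
  rw [List.map_append, List.map_append, List.sum_append, List.sum_append] at this
  exact hp this.symm

variable [Algebra ℚ K]

theorem algebraMap_inv_mul_natCast {n : ℕ} (hn : n ≠ 0) :
    algebraMap ℚ K (n : ℚ)⁻¹ * (n : K) = 1 := by
  rw [← map_natCast (algebraMap ℚ K) n, ← map_mul, inv_mul_cancel₀ (Nat.cast_ne_zero.2 hn), map_one]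

/-- The cyclic derivative, divided by the length of words. -/
def normCycDeriv (d : I → ℤ) : TSeries K I →L[K] Pro K (List I × List I) :=
  (diag fun p => algebraMap ℚ K ((p.1.length + p.2.length : ℕ) : ℚ)⁻¹).comp (cycDeriv d)

theorem normCycDeriv_commutators {d : I → ℤ} {f : TSeries K I} (hf : f ∈ commutators K d) :
    normCycDeriv d f = 0 := by
  rw [normCycDeriv, ContinuousLinearMap.comp_apply, cycDeriv_commutators hf, map_zero]

theorem normCycDeriv_of_suppOn {d : I → ℤ} {n : ℕ} {f : TSeries K I}
    (hf : SuppOn List.length n f) :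
    normCycDeriv d f = algebraMap ℚ K (n : ℚ)⁻¹ • cycDeriv d f := by
  refine hf.map_eq (B := algebraMap ℚ K (n : ℚ)⁻¹ • cycDeriv d) ?_
  rintro w rfl
  rw [normCycDeriv, ContinuousLinearMap.comp_apply, cycDeriv_single,
    _root_.smul_apply, cycDeriv_single]
  exact (rotWord_length d w).diag_eq fun p hp => by rw [hp]

/-- `L̂W ⊗ L̂W → T̂W → T̂W ⊗ T̂W`, the product followed by the normalised cyclic derivative, is the
identity modulo the relations of Lie 0-forms. -/
theorem normCycDeriv_mu_sub_mem {d : I → ℤ} {F : Pro K (List I × List I)}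
    (hF : F ∈ lieTensor K d) : normCycDeriv d (mu F) - F ∈ lieRelations K d := by
  refine lieTensor_map_mem ((normCycDeriv d).comp mu - ContinuousLinearMap.id K _)
    (isClosed_closedSpan _) (fun x y hx hy => ?_) hF
  change normCycDeriv d (mu (tmul x y)) - tmul x y ∈ lieRelations K d
  obtain ⟨j, hj, hx'⟩ := rot_sub_mem_lieRelations hx
  obtain ⟨k, hk, hy'⟩ := rot_sub_mem_lieRelations hy
  obtain ⟨p, j', hj0, hp, hj'⟩ := hx.exists_suppOn
  obtain ⟨q, -, -, hq, -⟩ := hy.exists_suppOn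
  by_cases hjk : j + k = 0
  · -- `x` is then supported in two different lengths, hence zero
    have hx0 : x = 0 := by
      funext w
      by_cases hw : w.length = j
      · exact hj' w (by omega)
      · exact hj w hw
    rw [hx0, ← tmulL_apply, map_zero, map_zero, map_zero, sub_self]
    exact zero_mem _
  have hs : SuppOn List.length (j + k) (mu (tmul x y)) :=
    hj.mul (fun _ _ => List.length_append) hk
  have h1 := hx' y hy
  have h2 := Submodule.smul_mem _ (sg K (p * q)) (hy' x hx)
  have h3 := Submodule.smul_mem _ (k : K) (lieRelations_symm hx.mem hy.mem hp hq)
  have h4 := Submodule.smul_mem _ (algebraMap ℚ K ((j + k : ℕ) : ℚ)⁻¹) (sub_mem (add_mem h1 h2) h3)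
  have e : normCycDeriv d (mu (tmul x y)) - tmul x y = algebraMap ℚ K ((j + k : ℕ) : ℚ)⁻¹ •
      (cycDeriv d (mu (tmul x y)) - ((j + k : ℕ) : K) • tmul x y) := by
    rw [smul_sub, smul_smul, algebraMap_inv_mul_natCast hjk, one_smul, normCycDeriv_of_suppOn hs]
  rw [e]
  convert h4 using 2
  rw [cycDeriv_mu, swap_tmul_of_suppOn hp hq, map_smul]
  simp only [smul_sub, smul_smul, Nat.cast_add, add_smul, mul_comm (k : K)]
  abel

/-- `T̂W → T̂W ⊗ T̂W → T̂W`, the normalised cyclic derivative followed by the product, is the identity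
modulo commutators on series without constant term. -/
theorem mu_normCycDeriv_sub_mem {d : I → ℤ} {f : TSeries K I} (hf : f [] = 0) :
    mu (normCycDeriv d f) - f ∈ commutators K d := by
  classical
  let A : TSeries K I →L[K] TSeries K I := mu.comp (normCycDeriv d) -
    diag fun w => if w = [] then 0 else 1
  have hA : A f ∈ commutators K d := by
    refine mem_of_single A (T := commutators K d) (isClosed_closedSpan _) (fun w => ?_) f
    change mu (normCycDeriv d (single w)) - diag _ (single w : TSeries K I) ∈ commutators K d
    rw [diag_single, normCycDeriv_of_suppOn (suppOn_single List.length w), cycDeriv_single]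
    by_cases hw : w = []
    · subst hw
      simp [rotWord]
    · have h1 := Submodule.smul_mem _ (algebraMap ℚ K (w.length : ℚ)⁻¹)
        (mu_rotWord (K := K) d w [])
      have hl : w.length ≠ 0 := by simpa using hw
      rw [smul_sub, smul_smul, algebraMap_inv_mul_natCast hl, List.append_nil] at h1
      simpa [hw] using h1
  have e : diag (fun w => if w = [] then (0 : K) else 1) f = f := by
    funext w
    by_cases hw : w = []
    · simp [hw, hf]
    · simp [hw]
  change mu (normCycDeriv d f) - diag _ f ∈ _ at hA
  rwa [e] at hA

end Cyclic

/-! ### The shuffle coproduct -/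

section Coproduct

variable {K : Type*} [CommRing K] {I : Type*}

open Pro

theorem sg_mul_mem_addSubgroup (S : AddSubgroup K) (k : ℤ) {a : K} (ha : a ∈ S) : sg K k * a ∈ S :=
  sg_mul_mem (fun _ => S) k 0 ha

/-- The coefficient of `Δ f` at `u ⊗ v` is a signed sum of coefficients of `f` at permutations of the
word `u v`. -/
theorem comulFun_mem (d : I → ℤ) (S : AddSubgroup K) : ∀ (f : TSeries K I) (u v : List I),
    (∀ w, w.Perm (u ++ v) → f w ∈ S) → comulFun d f u v ∈ S
  | f, [], v, h => by
    rw [comulFun]; exact h v (List.Perm.refl _)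
  | f, a :: u, [], h => by
    rw [comulFun]; exact h _ (by simp)
  | f, a :: u, b :: v, h => by
    rw [comulFun]
    refine add_mem (comulFun_mem d S _ u (b :: v) fun w hw => h _ (hw.cons a))
      (sg_mul_mem_addSubgroup S _ (comulFun_mem d S _ (a :: u) v fun w hw => h _ ?_))
    exact (hw.cons b).trans List.perm_middle.symm
termination_by _ u v => u.length + v.length

theorem comulFun_nil_right (d : I → ℤ) (f : TSeries K I) (u : List I) :
    comulFun d f u [] = f u := by
  cases u <;> simp [comulFun]

theorem continuous_comulFun (d : I → ℤ) : ∀ u v : List I,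
    @Continuous (TSeries K I) K _ ⊥ (fun f => comulFun d f u v)
  | [], v => by
    simp only [comulFun]
    exact continuous_coord v
  | a :: u, [] => by
    simp only [comulFun]
    exact continuous_coord (a :: u)
  | a :: u, b :: v => by
    let _ : TopologicalSpace K := ⊥
    have : DiscreteTopology K := ⟨rfl⟩
    simp only [comulFun]
    exact ((continuous_comulFun d u (b :: v)).comp (pull _).continuous).add
      (((continuous_comulFun d (a :: u) v).comp (pull _).continuous).const_mul _)
termination_by u v => u.length + v.length

/-- The shuffle coproduct as a continuous map. -/
def comulL (d : I → ℤ) : TSeries K I →L[K] Pro K (List I × List I) where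
  __ := comul d
  cont := continuous_of_coord fun p => continuous_comulFun d p.1 p.2

/-- The modified shuffle operator as a continuous map. -/
def shuffleL (d : I → ℤ) : TSeries K I →L[K] TSeries K I := mu.comp (comulL d)

theorem shuffleOp_apply_mem (d : I → ℤ) (S : AddSubgroup K) {f : TSeries K I} {w : List I}
    (h : ∀ w', w'.Perm w → f w' ∈ S) : shuffleOp d f w ∈ S := by
  change mu (comulL d f) w ∈ S
  rw [mu_apply]
  refine sum_mem fun k _ => comulFun_mem d S f _ _ fun w' hw' => h w' ?_
  rwa [List.take_append_drop] at hw'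

theorem pull_cons_mul_gen [DecidableEq I] (a b : I) (f : TSeries K I) :
    pull (fun w => b :: w) (mul (gen a) f) = (if b = a then 1 else 0 : K) • f := by
  have : (pull fun w => b :: w).comp (mulR (gen a)) =
      (if b = a then 1 else 0 : K) • ContinuousLinearMap.id K (TSeries K I) := hom_ext fun w => by
    change pull (fun w => b :: w) (mul (single [a]) (single w)) = _
    rw [mul_single]
    funext v
    by_cases h : b = a <;> simp [single, h]
  exact congrArg (· f) this

theorem mul_gen_cons [DecidableEq I] (a b : I) (f : TSeries K I) (w : List I) :
    mul (gen a) f (b :: w) = (if b = a then 1 else 0 : K) * f w :=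
  congrFun (pull_cons_mul_gen a b f) w

theorem mul_gen_nil (a : I) (f : TSeries K I) : mul (gen a) f [] = 0 := by
  rw [mul, mu_nil, tmul_apply, gen, single_apply_ne (by simp), zero_mul]

/-- The multiplication `F ↦ (1 ⊗ x) F` for the graded product of `T̂W ⊗ T̂W`. -/
def innerMul (d : I → ℤ) (x : TSeries K I) :
    Pro K (List I × List I) →L[K] Pro K (List I × List I) where
  toFun F := fun p => mul (twist d (wdeg d p.1) x) (pull (fun v => (p.1, v)) F) p.2
  map_add' F G := by funext p; rw [map_add, mul_add']; rfl
  map_smul' c F := by funext p; rw [map_smul, mul_smul']; rfl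
  cont := by
    let _ : TopologicalSpace K := ⊥
    exact continuous_of_coord fun p =>
      (continuous_coord p.2).comp ((mulR _).continuous.comp (pull _).continuous)

/-- The map `x ↦ (1 ⊗ x) F`. -/
def innerMulL (d : I → ℤ) (F : Pro K (List I × List I)) :
    TSeries K I →L[K] Pro K (List I × List I) where
  toFun x := innerMul d x F
  map_add' x y := by
    funext p
    change mul (twist d (wdeg d p.1) (x + y)) (pull (fun v => (p.1, v)) F) p.2 = _
    rw [map_add, add_mul']; rfl
  map_smul' c x := by
    funext p
    change mul (twist d (wdeg d p.1) (c • x)) (pull (fun v => (p.1, v)) F) p.2 = _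
    rw [map_smul, smul_mul']; rfl
  cont := by
    let _ : TopologicalSpace K := ⊥
    exact continuous_of_coord fun p =>
      (continuous_coord p.2).comp ((mulL _).continuous.comp (twist d _).continuous)

/-- The map `x ↦ (x ⊗ 1) F`. -/
def outerMulL (F : Pro K (List I × List I)) : TSeries K I →L[K] Pro K (List I × List I) where
  toFun x := mapL (mulR x) F
  map_add' x y := by
    funext p
    exact congrFun (add_mul' x y (pull (fun u => (u, p.2)) F)) p.1
  map_smul' c x := by
    funext p
    exact congrFun (smul_mul' c x (pull (fun u => (u, p.2)) F)) p.1
  cont := by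
    let _ : TopologicalSpace K := ⊥
    exact continuous_of_coord fun p => (continuous_coord p.1).comp (mulL _).continuous

theorem innerMul_tmul_of_suppOn {d : I → ℤ} {r : ℤ} {f : TSeries K I} (hf : SuppOn (wdeg d) r f)
    (x g : TSeries K I) : innerMul d x (tmul f g) = tmul f (mul (twist d r x) g) := by
  funext p
  have h : pull (fun v => (p.1, v)) (tmul f g) = f p.1 • g := rfl
  change mul (twist d (wdeg d p.1) x) (pull (fun v => (p.1, v)) (tmul f g)) p.2 =
    f p.1 * mul (twist d r x) g p.2
  rw [h, mul_smul', Pro.smul_apply]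
  by_cases h1 : wdeg d p.1 = r
  · rw [h1]
  · rw [hf _ h1, zero_mul, zero_mul]

/-- For a generator `tₐ`, the sign in `(1 ⊗ tₐ)(f ⊗ g)` is a twist of `f`, without any homogeneity
assumption. -/
theorem innerMul_gen_tmul (d : I → ℤ) (a : I) (f g : TSeries K I) :
    innerMul d (gen a) (tmul f g) = tmul (twist d (d a) f) (mul (gen a) g) := by
  have : (innerMul d (gen a)).comp (tmulL g) = (tmulL (mul (gen a) g)).comp (twist d (d a)) :=
    hom_ext fun u => by
      change innerMul d (gen a) (tmul (single u) g) =
        tmul (twist d (d a) (single u)) (mul (gen a) g)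
      rw [innerMul_tmul_of_suppOn (suppOn_single _ u), gen, twist_single, twist_single, smul_mul',
        tmul_smul', smul_tmul']
      congr 2
      simp [mul_comm]
  exact congrArg (· f) this

/-- The multiplication `F ↦ (x ⊗ 1 + 1 ⊗ x) F` for the graded product of `T̂W ⊗ T̂W`. -/
def primMul (d : I → ℤ) (x : TSeries K I) :
    Pro K (List I × List I) →L[K] Pro K (List I × List I) := mapL (mulR x) + innerMul d x

theorem primMul_apply (d : I → ℤ) (x : TSeries K I) (F : Pro K (List I × List I)) :
    primMul d x F = mapL (mulR x) F + innerMul d x F := rfl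

theorem primMul_tmul_of_suppOn {d : I → ℤ} {r : ℤ} {f : TSeries K I} (hf : SuppOn (wdeg d) r f)
    (x g : TSeries K I) :
    primMul d x (tmul f g) = tmul (mul x f) g + tmul f (mul (twist d r x) g) := by
  rw [primMul_apply, mapL_tmul, innerMul_tmul_of_suppOn hf]; rfl

theorem primMul_tmul {d : I → ℤ} {p r : ℤ} {x f : TSeries K I} (hx : SuppOn (wdeg d) p x)
    (hf : SuppOn (wdeg d) r f) (g : TSeries K I) :
    primMul d x (tmul f g) = tmul (mul x f) g + sg K (r * p) • tmul f (mul x g) := by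
  rw [primMul_tmul_of_suppOn hf, hx.twist_eq, smul_mul', tmul_smul']

theorem comul_gen_mul (d : I → ℤ) (a : I) (f : TSeries K I) :
    comulL d (mul (gen a) f) = primMul d (gen a) (comulL d f) := by
  classical
  funext p
  obtain ⟨u, v⟩ := p
  have e : primMul d (gen a) (comulL d f) (u, v) =
      mul (gen a) (pull (fun u => (u, v)) (comulL d f)) u +
        sg K (wdeg d u * d a) * mul (gen a) (pull (fun v => (u, v)) (comulL d f)) v := by
    have : twist d (wdeg d u) (gen a : TSeries K I) = sg K (wdeg d u * d a) • gen a := by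
      rw [gen, twist_single]; simp
    change mul (gen a) (pull (fun u => (u, v)) (comulL d f)) u +
      mul (twist d (wdeg d u) (gen a)) (pull (fun v => (u, v)) (comulL d f)) v = _
    rw [this, smul_mul', Pro.smul_apply]
  have e' : ∀ (f : TSeries K I) (u v : List I), comulL d f (u, v) = comulFun d f u v :=
    fun _ _ _ => rfl
  rw [e, e']
  cases u with
  | nil =>
    cases v with
    | nil => simp [comulFun, mul_gen_nil]
    | cons c v => simp [comulFun, mul_gen_nil, mul_gen_cons, e']
  | cons b u =>
    cases v with
    | nil => simp [comulFun_nil_right, mul_gen_nil, mul_gen_cons, e']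
    | cons c v =>
      rw [comulFun, pull_cons_mul_gen, pull_cons_mul_gen, comulFun_smul, comulFun_smul,
        mul_gen_cons, mul_gen_cons, pull_apply, pull_apply, e', e']
      by_cases hc : c = a
      · subst hc
        rw [mul_comm (d c)]
      · simp [hc]

/-- `x ↦ x ⊗ 1 + 1 ⊗ x` is compatible with graded commutators. -/
theorem primMul_bracket {d : I → ℤ} {p q : ℤ} {x y : TSeries K I} (hx : SuppOn (wdeg d) p x)
    (hy : SuppOn (wdeg d) q y) (F : Pro K (List I × List I)) :
    primMul d (bracket d x y) F =
      primMul d x (primMul d y F) - sg K (p * q) • primMul d y (primMul d x F) := by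
  have : primMul d (bracket d x y) = (primMul d x).comp (primMul d y) -
      sg K (p * q) • (primMul d y).comp (primMul d x) := hom_ext fun F => by
    obtain ⟨u, v⟩ := F
    have hu : SuppOn (wdeg d) (wdeg d u) (single u : TSeries K I) := suppOn_single _ u
    rw [single_prod]
    change primMul d (bracket d x y) (tmul (single u) (single v)) =
      primMul d x (primMul d y (tmul (single u) (single v))) -
        sg K (p * q) • primMul d y (primMul d x (tmul (single u) (single v)))
    -- the mixed terms `x u ⊗ y v` and `y u ⊗ x v` of the two products cancel
    rw [primMul_tmul (hx.bracket hy) hu, primMul_tmul hy hu, primMul_tmul hx hu, map_add, map_add,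
      map_smul, map_smul, primMul_tmul hx (hy.mul (wdeg_append d) hu), primMul_tmul hx hu,
      primMul_tmul hy (hx.mul (wdeg_append d) hu), primMul_tmul hy hu, bracket_of_suppOn hx hy,
      sub_mul', sub_mul', smul_mul', smul_mul', ← tmulL_apply, ← tmulR_apply (single u) (_ - _),
      map_sub, map_sub, map_smul, map_smul]
    simp only [tmulL_apply, tmulR_apply, mul_assoc', smul_add, smul_sub, smul_smul, ← sg_add]
    rw [sg_congr (K := K) (m := p * q + (p + wdeg d u) * q) (n := wdeg d u * q)
        ⟨p * q, by ring⟩,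
      sg_congr (K := K) (m := (q + wdeg d u) * p) (n := p * q + wdeg d u * p) ⟨0, by ring⟩,
      sg_congr (K := K) (m := wdeg d u * (p + q)) (n := wdeg d u * q + wdeg d u * p)
        ⟨0, by ring⟩,
      sg_congr (K := K) (m := wdeg d u * (p + q) + p * q)
        (n := p * q + (wdeg d u * p + wdeg d u * q)) ⟨0, by ring⟩]
    abel
  exact congrArg (· F) this

/-- Lie series are primitive, which is expressed by the multiplicativity of the coproduct. -/
theorem comul_mul {d : I → ℤ} {x : TSeries K I} (hx : x ∈ lieSeries K d) (g : TSeries K I) :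
    comulL d (mul x g) = primMul d x (comulL d g) := by
  have hmono : ∀ x : TSeries K I, IsLieMonomial d x → ∀ g,
      comulL d (mul x g) = primMul d x (comulL d g) := by
    intro x hx
    induction hx with
    | gen a => exact comul_gen_mul d a
    | bracket x y hx hy ihx ihy =>
      intro g
      obtain ⟨p, -, -, hp, -⟩ := hx.exists_suppOn
      obtain ⟨q, -, -, hq, -⟩ := hy.exists_suppOn
      rw [primMul_bracket hp hq, ← ihy, ← ihx, ← ihx, ← ihy, bracket_of_suppOn hp hq, sub_mul',
        smul_mul', mul_assoc', mul_assoc', map_sub, map_smul]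
  have h := map_closedSpan ((comulL d).comp (mulL g) -
    (outerMulL (comulL d g) + innerMulL d (comulL d g))) (T := ⊥) (by simp)
    (fun x hx => (Submodule.mem_bot K).2 (sub_eq_zero.2 (hmono x hx g))) x hx
  exact sub_eq_zero.1 ((Submodule.mem_bot K).1 h)

/-- On `f ⊗ g` this reads `x f g ± f x g = 2 x f g - [x, f] g`. -/
theorem mu_primMul (d : I → ℤ) (x : TSeries K I) (F : Pro K (List I × List I)) :
    mu (primMul d x F) = (2 : K) • mul x (mu F) - mu (mapL (bracketR d x) F) := by
  have : mu.comp (primMul d x) = (2 : K) • (mulR x).comp mu - mu.comp (mapL (bracketR d x)) :=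
    hom_ext fun F => by
      obtain ⟨u, v⟩ := F
      rw [single_prod]
      change mu (primMul d x (tmul (single u) (single v))) =
        (2 : K) • mul x (mul (single u) (single v)) -
          mu (mapL (bracketR d x) (tmul (single u) (single v)))
      rw [primMul_tmul_of_suppOn (suppOn_single _ u), mapL_tmul, bracketR_apply,
        bracket_single_right, map_add, two_smul]
      change mul (mul x (single u)) (single v) + mul (single u) (mul _ (single v)) = _ -
        mul (_ - _) (single v)
      rw [sub_mul', mul_assoc', mul_assoc']
      abel
  exact congrArg (· F) this

theorem comul_one (d : I → ℤ) : comulL d (single []) = (tmul (single []) (single []) : Pro K _) := by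
  funext p
  obtain ⟨u, v⟩ := p
  change comulFun d (single []) u v = single [] u * single [] v
  cases u with
  | nil => simp [comulFun, single_apply_self]
  | cons a u =>
    rw [single_apply_ne (by simp), zero_mul]
    by_contra h
    refine h (comulFun_mem d ⊥ _ _ _ fun w hw => ?_)
    refine single_apply_ne fun hw' => ?_
    subst hw'
    simpa using hw.length_eq

theorem shuffleOp_one (d : I → ℤ) : shuffleOp d (single [] : TSeries K I) = single [] := by
  change mu (comulL d (single [])) = single []
  rw [comul_one, mu_single]; rfl

theorem shuffleOp_mul {d : I → ℤ} {x : TSeries K I} (hx : x ∈ lieSeries K d) (g : TSeries K I) :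
    shuffleOp d (mul x g) =
      (2 : K) • mul x (shuffleOp d g) - mu (mapL (bracketR d x) (comulL d g)) := by
  change mu (comulL d (mul x g)) = _
  rw [comul_mul hx, mu_primMul]; rfl

theorem comul_lie {d : I → ℤ} {x : TSeries K I} (hx : x ∈ lieSeries K d) :
    comulL d x = tmul x (single []) + tmul (single []) x := by
  have h : twist d 0 x = x := by
    funext w; simp [twist]
  rw [← mul_one' x, comul_mul hx, comul_one, primMul_tmul_of_suppOn (suppOn_single _ []),
    wdeg_nil, mul_one', h, mul_one']

theorem shuffleOp_lie {d : I → ℤ} {x : TSeries K I} (hx : x ∈ lieSeries K d) :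
    shuffleOp d x = (2 : K) • x := by
  change mu (comulL d x) = _
  rw [comul_lie hx, map_add]
  change mul x (single []) + mul (single []) x = _
  rw [mul_one', one_mul', two_smul]

theorem mapL_bracketR_tmul_single_nil (d : I → ℤ) (x : TSeries K I) (g : TSeries K I) :
    mapL (bracketR d x) (tmul (single []) g) = 0 := by
  have h : twist d 0 x = x := by
    funext w; simp [twist]
  rw [mapL_tmul, bracketR_apply, bracket_single_right, wdeg_nil, h, mul_one', one_mul', sub_self,
    ← tmulL_apply, map_zero]

/-- For Lie series `x` and `y`, `s(x y) = 3 x y ± y x`. -/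
theorem shuffleOp_mu {d : I → ℤ} {F : Pro K (List I × List I)}
    (hF : F ∈ lieTensor K d) :
    shuffleOp d (mu F) = (3 : K) • mu F + mu (swap d F) := by
  have h := lieTensor_map_mem ((shuffleL d).comp mu - ((3 : K) • mu + mu.comp (swap d))) (T := ⊥)
    (by simp) (fun x y hx hy => (Submodule.mem_bot K).2 (sub_eq_zero.2 ?_)) hF
  · exact sub_eq_zero.1 ((Submodule.mem_bot K).1 h)
  change shuffleOp d (mul x y) = (3 : K) • mul x y + mu (swap d (tmul x y))
  have h3 : (3 : K) = 2 * 2 - 1 := by norm_num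
  rw [shuffleOp_mul hx.mem, shuffleOp_lie hy.mem, comul_lie hy.mem, map_add,
    mapL_bracketR_tmul_single_nil, add_zero, mapL_tmul]
  change _ - mul (bracket d x y) (single []) = _
  rw [mul_one', bracket, mul_smul', smul_smul, h3, sub_smul, one_smul]
  change _ - (mul x y - _) = _
  abel

/-- `δ` is a graded derivation of `T̂W` which changes the parity of degrees by that of `k`; the latter
is expressed by the commutation with the operators `x ↦ (-1)^{j|x|} x`. -/
structure IsDeriv (d : I → ℤ) (k : ℤ) (δ : TSeries K I →L[K] TSeries K I) : Prop where
  map_mul : ∀ f g, δ (mul f g) = mul (δ f) g + mul (twist d k f) (δ g)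
  map_twist : ∀ j f, δ (twist d j f) = sg K (j * k) • twist d j (δ f)

/-- The operator `δ ⊗ 1 + 1 ⊗ δ` on `T̂W ⊗ T̂W`, for an operator `δ` of parity `k`. -/
def derivTensor (d : I → ℤ) (k : ℤ) (δ : TSeries K I →L[K] TSeries K I) :
    Pro K (List I × List I) →L[K] Pro K (List I × List I) :=
  mapL δ + (mapR δ).comp (diag fun p => sg K (k * wdeg d p.1))

theorem derivTensor_tmul (d : I → ℤ) (k : ℤ) (δ : TSeries K I →L[K] TSeries K I)
    (f g : TSeries K I) :
    derivTensor d k δ (tmul f g) = tmul (δ f) g + tmul (twist d k f) (δ g) := by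
  have : diag (fun p : List I × List I => sg K (k * wdeg d p.1)) (tmul f g) =
      tmul (twist d k f) g := by
    funext p; simp [twist, mul_assoc]
  simp [derivTensor, mapL_tmul, mapR_tmul, this]

namespace IsDeriv

variable {d : I → ℤ} {k : ℤ} {δ : TSeries K I →L[K] TSeries K I}

theorem map_one (hδ : IsDeriv d k δ) : δ (single []) = 0 := by
  have h := hδ.map_mul (single []) (single [])
  rw [one_mul', mul_one', twist_single] at h
  simpa [one_mul'] using h

theorem derivTensor_primMul_gen (hδ : IsDeriv d k δ) (a : I) (F : Pro K (List I × List I)) :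
    derivTensor d k δ (primMul d (gen a) F) =
      primMul d (δ (gen a)) F + sg K (k * d a) • primMul d (gen a) (derivTensor d k δ F) := by
  have : (derivTensor d k δ).comp (primMul d (gen a)) = primMul d (δ (gen a)) +
      sg K (k * d a) • (primMul d (gen a)).comp (derivTensor d k δ) := hom_ext fun F => by
    obtain ⟨u, v⟩ := F
    have hu : SuppOn (wdeg d) (wdeg d u) (single u : TSeries K I) := suppOn_single _ u
    have ha : SuppOn (wdeg d) (d a) (gen a : TSeries K I) := by
      simpa [gen] using suppOn_single (K := K) (wdeg d) [a]
    have h1 : δ (mul (gen a) (single u)) =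
        mul (δ (gen a)) (single u) + sg K (k * d a) • mul (gen a) (δ (single u)) := by
      rw [hδ.map_mul, ha.twist_eq, smul_mul']
    have h2 : δ (mul (gen a) (single v)) =
        mul (δ (gen a)) (single v) + sg K (k * d a) • mul (gen a) (δ (single v)) := by
      rw [hδ.map_mul, ha.twist_eq, smul_mul']
    have h3 : twist d (d a) (δ (single u)) =
        (sg K (k * d a) * sg K (wdeg d u * d a)) • δ (single u) := by
      have := hδ.map_twist (d a) (single u)
      rw [hu.twist_eq, map_smul] at this
      rw [mul_comm (wdeg d u), mul_smul, this, smul_smul, mul_comm k, sg_mul_self, one_smul]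
    have h4 : twist d (wdeg d u) (δ (gen a)) =
        (sg K (k * wdeg d u) * sg K (wdeg d u * d a)) • δ (gen a) := by
      have := hδ.map_twist (wdeg d u) (gen a)
      rw [ha.twist_eq, map_smul] at this
      rw [mul_smul, this, smul_smul, mul_comm k, sg_mul_self, one_smul]
    rw [single_prod]
    change derivTensor d k δ (primMul d (gen a) (tmul (single u) (single v))) =
      primMul d (δ (gen a)) (tmul (single u) (single v)) +
        sg K (k * d a) • primMul d (gen a) (derivTensor d k δ (tmul (single u) (single v)))
    rw [primMul_tmul ha hu, map_add, map_smul, derivTensor_tmul, derivTensor_tmul,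
      derivTensor_tmul, (ha.mul (wdeg_append d) hu).twist_eq, hu.twist_eq, h1, h2,
      primMul_tmul_of_suppOn hu, h4, map_add, smul_tmul', smul_tmul', smul_tmul', map_smul,
      primMul_tmul ha hu, primMul_apply _ _ (tmul (δ _) _), mapL_tmul, innerMul_gen_tmul, h3,
      smul_tmul', smul_mul', tmul_smul', ← tmulL_apply, ← tmulR_apply (single u) (_ + _), map_add,
      map_add, map_smul, map_smul]
    simp only [tmulL_apply, tmulR_apply, mulR_apply, smul_add, smul_smul, ← sg_add]
    rw [sg_congr (K := K) (m := k * d a + (k * d a + wdeg d u * d a)) (n := wdeg d u * d a)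
        ⟨k * d a, by ring⟩,
      sg_congr (K := K) (m := k * (d a + wdeg d u)) (n := k * d a + k * wdeg d u) ⟨0, by ring⟩,
      sg_congr (K := K) (m := wdeg d u * d a + k * wdeg d u) (n := k * wdeg d u + wdeg d u * d a)
        ⟨0, by ring⟩,
      sg_congr (K := K) (m := wdeg d u * d a + (k * wdeg d u + k * d a))
        (n := k * d a + (k * wdeg d u + wdeg d u * d a)) ⟨0, by ring⟩]
    abel
  exact congrArg (· F) this

/-- A derivation of `T̂W` which maps `W` to `L̂W` is also a coderivation. -/
theorem comul_apply (hδ : IsDeriv d k δ) (hgen : ∀ a, δ (gen a) ∈ lieSeries K d)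
    (f : TSeries K I) : comulL d (δ f) = derivTensor d k δ (comulL d f) := by
  have : (comulL d).comp δ = (derivTensor d k δ).comp (comulL d) := hom_ext fun w => by
    change comulL d (δ (single w)) = derivTensor d k δ (comulL d (single w))
    induction w with
    | nil =>
      rw [hδ.map_one, comul_one, derivTensor_tmul, hδ.map_one, map_zero, ← tmulL_apply, map_zero,
        ← tmulR_apply, map_zero, add_zero]
    | cons a w ih =>
      have ha : SuppOn (wdeg d) (d a) (gen a : TSeries K I) := by
        simpa [gen] using suppOn_single (K := K) (wdeg d) [a]
      have e : (single (a :: w) : TSeries K I) = mul (gen a) (single w) := by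
        rw [gen, mul_single]; rfl
      rw [e, hδ.map_mul, ha.twist_eq, smul_mul', map_add, map_smul, comul_mul (hgen a),
        comul_gen_mul, comul_gen_mul, ih, hδ.derivTensor_primMul_gen]
  exact congrArg (· f) this

theorem mu_derivTensor (hδ : IsDeriv d k δ) (F : Pro K (List I × List I)) :
    mu (derivTensor d k δ F) = δ (mu F) := by
  have : mu.comp (derivTensor d k δ) = δ.comp mu := hom_ext fun F => by
    obtain ⟨u, v⟩ := F
    rw [single_prod]
    change mu (derivTensor d k δ (tmul (single u) (single v))) = δ (mul (single u) (single v))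
    rw [derivTensor_tmul, map_add, hδ.map_mul]; rfl
  exact congrArg (· F) this

theorem shuffleOp_apply (hδ : IsDeriv d k δ) (hgen : ∀ a, δ (gen a) ∈ lieSeries K d)
    (f : TSeries K I) : shuffleOp d (δ f) = δ (shuffleOp d f) := by
  change mu (comulL d (δ f)) = δ (mu (comulL d f))
  rw [hδ.comul_apply hgen, hδ.mu_derivTensor]

end IsDeriv

theorem bracket_gen (d : I → ℤ) (a : I) (f : TSeries K I) :
    bracket d (gen a) f = mul (gen a) f - mul (twist d (d a) f) (gen a) := by
  rw [bracket, gen, swap_single_tmul]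
  simp [mul]

theorem isDeriv_bracketR_gen (d : I → ℤ) (a : I) :
    IsDeriv d (d a) (bracketR d (gen a) : TSeries K I →L[K] TSeries K I) where
  map_mul f g := by
    simp only [bracketR_apply, bracket_gen, HomologicalLieField.twist_mul, sub_mul', mul_sub',
      mul_assoc']
    abel
  map_twist j f := by
    have h : twist d (d a) (twist d j f) = twist d j (twist d (d a) f) := by
      funext w; simp [twist, mul_left_comm]
    have ha : twist d j (gen a : TSeries K I) = sg K (j * d a) • gen a := by
      rw [gen, twist_single]; simp
    simp only [bracketR_apply, bracket_gen, map_sub, HomologicalLieField.twist_mul, ha, smul_mul',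
      mul_smul', smul_sub, smul_smul, sg_mul_self, one_smul, h]

/-- The adjoint action of a generator is a derivation and a coderivation. Therefore the shuffle
operator preserves commutators. -/
theorem shuffleOp_bracket_gen (d : I → ℤ) (a : I) (f : TSeries K I) :
    shuffleOp d (bracket d (gen a) f) = bracket d (gen a) (shuffleOp d f) :=
  (isDeriv_bracketR_gen d a).shuffleOp_apply (fun b => bracket_mem d (gen_mem d a) (gen_mem d b)) f

/-- The commutators of generators with words generate all commutators. -/
theorem map_commutators {d : I → ℤ} {Y : Type*} (A : TSeries K I →L[K] Pro K Y)
    {T : Submodule K (Pro K Y)} (hT : IsClosed (T : Set (Pro K Y)))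
    (h : ∀ a w, A (bracket d (gen a) (single w)) ∈ T) {f : TSeries K I}
    (hf : f ∈ commutators K d) : A f ∈ T := by
  have h1 : ∀ u v : List I, A (bracket d (single u) (single v)) ∈ T := by
    intro u
    induction u with
    | nil =>
      intro v
      rw [bracket_single]
      simp
    | cons a u ih =>
      intro v
      have key := add_mem (h a (u ++ v))
        (T.smul_mem (sg K (d a * (wdeg d u + wdeg d v))) (ih (v ++ [a])))
      convert key using 1
      rw [← map_smul, ← map_add]
      congr 1
      rw [gen, bracket_single, bracket_single, bracket_single]
      simp only [wdeg_append, wdeg_cons, wdeg_nil, add_zero, smul_sub, smul_smul, ← sg_add,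
        List.cons_append, List.nil_append, List.append_assoc]
      rw [sg_congr (K := K) (m := d a * (wdeg d u + wdeg d v) + wdeg d u * (wdeg d v + d a))
        (n := (d a + wdeg d u) * wdeg d v) ⟨d a * wdeg d u, by ring⟩]
      abel
  refine map_closedSpan A hT ?_ f hf
  rintro _ ⟨f, g, rfl⟩
  have h2 : ∀ u : List I, A (bracket d (single u) g) ∈ T := fun u =>
    mem_of_single (A.comp (bracketR d (single u))) hT (fun v => h1 u v) g
  exact mem_of_single (A.comp (bracketL d g)) hT (fun u => h2 u) f

end Coproduct

/-! ### Products of Lie monomials and the shuffle operator -/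

section Filtration

variable {K : Type*} [CommRing K] {I : Type*} {d : I → ℤ}

open Pro

/-- `f` is a product of `n` Lie monomials. -/
inductive IsLieProduct (d : I → ℤ) : ℕ → TSeries K I → Prop
  | one : IsLieProduct d 0 (single [])
  | mul {n : ℕ} {x f : TSeries K I} : IsLieMonomial d x → IsLieProduct d n f →
      IsLieProduct d (n + 1) (mul x f)

theorem IsLieProduct.append {m n : ℕ} {f g : TSeries K I} (hf : IsLieProduct d m f)
    (hg : IsLieProduct d n g) : IsLieProduct d (m + n) (FormalNC.mul f g) := by
  induction hf with
  | one => rwa [one_mul', zero_add]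
  | mul hx _ ih =>
    rw [mul_assoc', add_right_comm]
    exact IsLieProduct.mul hx ih

theorem IsLieProduct.exists_suppOn {n : ℕ} {f : TSeries K I} (hf : IsLieProduct d n f) :
    ∃ p, SuppOn (wdeg d) p f := by
  induction hf with
  | one => exact ⟨_, suppOn_single _ []⟩
  | mul hx _ ih =>
    obtain ⟨p, -, -, hp, -⟩ := hx.exists_suppOn
    obtain ⟨q, hq⟩ := ih
    exact ⟨_, hp.mul (wdeg_append d) hq⟩

theorem isLieProduct_single (d : I → ℤ) (w : List I) :
    IsLieProduct d w.length (single w : TSeries K I) := by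
  induction w with
  | nil => exact IsLieProduct.one
  | cons a w ih =>
    have : (single (a :: w) : TSeries K I) = mul (gen a) (single w) := by
      rw [gen, mul_single]; rfl
    rw [this]
    exact IsLieProduct.mul (IsLieMonomial.gen a) ih

/-- The span of the products of fewer than `j` Lie monomials. -/
def lieFilt (K : Type*) [CommRing K] (d : I → ℤ) (j : ℕ) : Submodule K (TSeries K I) :=
  Submodule.span K {f | ∃ n < j, IsLieProduct d n f}

/-- The filtration of `T̂W ⊗ T̂W` by the total number of Lie factors. -/
def lieFiltTensor (K : Type*) [CommRing K] (d : I → ℤ) (j : ℕ) :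
    Submodule K (Pro K (List I × List I)) :=
  Submodule.span K {F | ∃ m n f g, m + n < j ∧ IsLieProduct d m f ∧ IsLieProduct d n g ∧
    F = tmul f g}

theorem IsLieProduct.mem_lieFilt {n j : ℕ} {f : TSeries K I} (hf : IsLieProduct d n f)
    (h : n < j) : f ∈ lieFilt K d j := Submodule.subset_span ⟨n, h, hf⟩

theorem single_mem_lieFilt (d : I → ℤ) (w : List I) :
    (single w : TSeries K I) ∈ lieFilt K d (w.length + 1) :=
  (isLieProduct_single d w).mem_lieFilt (Nat.lt_succ_self _)

theorem lieFilt_mono {i j : ℕ} (h : i ≤ j) : lieFilt K d i ≤ lieFilt K d j :=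
  Submodule.span_mono fun _ ⟨n, hn, hf⟩ => ⟨n, hn.trans_le h, hf⟩

theorem lieFilt_zero : lieFilt K d 0 = ⊥ := by
  rw [lieFilt, Submodule.span_eq_bot]
  rintro f ⟨n, hn, -⟩
  omega

theorem mul_mem_lieFilt {x f : TSeries K I} (hx : IsLieMonomial d x) {j : ℕ}
    (hf : f ∈ lieFilt K d j) : mul x f ∈ lieFilt K d (j + 1) := by
  have : lieFilt K d j ≤ (lieFilt K d (j + 1)).comap (mulR x).toLinearMap :=
    Submodule.span_le.2 fun f ⟨n, hn, hf⟩ =>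
      (IsLieProduct.mul hx hf).mem_lieFilt (Nat.succ_lt_succ hn)
  exact this hf

theorem primMul_mem_lieFiltTensor {x : TSeries K I} (hx : IsLieMonomial d x) {j : ℕ}
    {F : Pro K (List I × List I)} (hF : F ∈ lieFiltTensor K d j) :
    primMul d x F ∈ lieFiltTensor K d (j + 1) := by
  have : lieFiltTensor K d j ≤ (lieFiltTensor K d (j + 1)).comap (primMul d x).toLinearMap := by
    refine Submodule.span_le.2 ?_
    rintro _ ⟨m, n, f, g, h, hf, hg, rfl⟩
    obtain ⟨p, -, -, hp, -⟩ := hx.exists_suppOn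
    obtain ⟨r, hr⟩ := hf.exists_suppOn
    change primMul d x (tmul f g) ∈ lieFiltTensor K d (j + 1)
    rw [primMul_tmul hp hr]
    exact add_mem
      (Submodule.subset_span ⟨m + 1, n, _, _, by omega, IsLieProduct.mul hx hf, hg, rfl⟩)
      (Submodule.smul_mem _ _
        (Submodule.subset_span ⟨m, n + 1, _, _, by omega, hf, IsLieProduct.mul hx hg, rfl⟩))
  exact this hF

theorem IsLieProduct.comul_mem {n : ℕ} {f : TSeries K I} (hf : IsLieProduct d n f) :
    comulL d f ∈ lieFiltTensor K d (n + 1) := by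
  induction hf with
  | one =>
    rw [comul_one]
    exact Submodule.subset_span ⟨0, 0, _, _, by omega, IsLieProduct.one, IsLieProduct.one, rfl⟩
  | mul hx _ ih =>
    rw [comul_mul hx.mem]
    exact primMul_mem_lieFiltTensor hx ih

theorem bracket_mul_of_suppOn {p q r : ℤ} {x y f : TSeries K I} (hx : SuppOn (wdeg d) p x)
    (hy : SuppOn (wdeg d) q y) (hf : SuppOn (wdeg d) r f) :
    bracket d x (mul y f) = mul (bracket d x y) f + sg K (p * q) • mul y (bracket d x f) := by
  rw [bracket_of_suppOn hx (hy.mul (wdeg_append d) hf), bracket_of_suppOn hx hy,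
    bracket_of_suppOn hx hf, sub_mul', mul_sub', smul_mul', mul_smul', smul_sub, smul_smul,
    mul_add, sg_add]
  simp only [mul_assoc']
  abel

theorem IsLieProduct.bracket_mem {x : TSeries K I} (hx : IsLieMonomial d x) {n : ℕ}
    {f : TSeries K I} (hf : IsLieProduct d n f) :
    bracket d x f ∈ Submodule.span K {g | IsLieProduct d n g} := by
  induction hf with
  | one =>
    obtain ⟨p, -, -, hp, -⟩ := hx.exists_suppOn
    have h : bracket d x (single []) = 0 := by
      rw [bracket_of_suppOn hp (suppOn_single _ []), one_mul', mul_one']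
      simp
    rw [h]
    exact zero_mem _
  | @mul n y f hy hf ih =>
    obtain ⟨p, -, -, hp, -⟩ := hx.exists_suppOn
    obtain ⟨q, -, -, hq, -⟩ := hy.exists_suppOn
    obtain ⟨r, hr⟩ := hf.exists_suppOn
    have h : Submodule.span K {g | IsLieProduct d n g} ≤
        (Submodule.span K {g | IsLieProduct d (n + 1) g}).comap (mulR y).toLinearMap :=
      Submodule.span_le.2 fun g hg => Submodule.subset_span (IsLieProduct.mul hy hg)
    rw [bracket_mul_of_suppOn hp hq hr]
    exact add_mem (Submodule.subset_span (IsLieProduct.mul (IsLieMonomial.bracket _ _ hx hy) hf))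
      (Submodule.smul_mem _ _ (h ih))

theorem mu_mapL_bracketR_mem {x : TSeries K I} (hx : IsLieMonomial d x) {j : ℕ}
    {F : Pro K (List I × List I)} (hF : F ∈ lieFiltTensor K d j) :
    mu (mapL (bracketR d x) F) ∈ lieFilt K d j := by
  have : lieFiltTensor K d j ≤
      (lieFilt K d j).comap (mu.comp (mapL (bracketR d x))).toLinearMap := by
    refine Submodule.span_le.2 ?_
    rintro _ ⟨m, n, f, g, h, hf, hg, rfl⟩
    change mu (mapL (bracketR d x) (tmul f g)) ∈ lieFilt K d j
    rw [mapL_tmul]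
    have h2 : Submodule.span K {g | IsLieProduct d m g} ≤
        (lieFilt K d j).comap (mulL g).toLinearMap :=
      Submodule.span_le.2 fun f' hf' => (hf'.append hg).mem_lieFilt h
    exact h2 (IsLieProduct.bracket_mem hx hf)
  exact this hF

/-- On products of `n` Lie monomials, the shuffle operator is multiplication by `2 ^ n` up to
products of fewer factors. -/
theorem IsLieProduct.shuffleOp_sub_mem {n : ℕ} {f : TSeries K I} (hf : IsLieProduct d n f) :
    shuffleOp d f - (2 : K) ^ n • f ∈ lieFilt K d n := by
  induction hf with
  | one =>
    rw [shuffleOp_one, pow_zero, one_smul, sub_self]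
    exact zero_mem _
  | @mul n x f hx hf ih =>
    have h1 := Submodule.smul_mem _ (2 : K) (mul_mem_lieFilt hx ih)
    have key := sub_mem h1 (mu_mapL_bracketR_mem hx hf.comul_mem)
    convert key using 1
    rw [shuffleOp_mul hx.mem, mul_sub', mul_smul', smul_sub, smul_smul, pow_succ']
    abel

theorem shuffleOp_sub_mem_lieFilt {j : ℕ} {f : TSeries K I} (hf : f ∈ lieFilt K d (j + 1)) :
    shuffleOp d f - (2 : K) ^ j • f ∈ lieFilt K d j := by
  have : lieFilt K d (j + 1) ≤
      (lieFilt K d j).comap (shuffleOp d - (2 : K) ^ j • (1 : Module.End K (TSeries K I))) := by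
    refine Submodule.span_le.2 ?_
    rintro f ⟨n, hn, hf⟩
    change shuffleOp d f - (2 : K) ^ j • f ∈ lieFilt K d j
    have h1 := hf.shuffleOp_sub_mem
    rcases Nat.lt_succ_iff_lt_or_eq.1 hn with h | rfl
    · have key := add_mem (lieFilt_mono h.le h1)
        (Submodule.smul_mem _ ((2 : K) ^ n - 2 ^ j) (hf.mem_lieFilt h))
      convert key using 1
      rw [sub_smul]
      abel
    · exact h1
  exact this hf

theorem shuffleOp_mem_lieFilt {j : ℕ} {f : TSeries K I} (hf : f ∈ lieFilt K d j) :
    shuffleOp d f ∈ lieFilt K d j := by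
  have h := shuffleOp_sub_mem_lieFilt (lieFilt_mono j.le_succ hf)
  have := add_mem h (Submodule.smul_mem _ ((2 : K) ^ j) hf)
  rwa [sub_add_cancel] at this

theorem swap_mem_lieTensor {F : Pro K (List I × List I)} (hF : F ∈ lieTensor K d) :
    swap d F ∈ lieTensor K d := by
  refine lieTensor_map_mem (swap d) (isClosed_closedSpan _) (fun x y hx hy => ?_) hF
  obtain ⟨p, -, -, hp, -⟩ := hx.exists_suppOn
  obtain ⟨q, -, -, hq, -⟩ := hy.exists_suppOn
  rw [swap_tmul_of_suppOn hp hq]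
  exact Submodule.smul_mem _ _ (subset_closedSpan _ ⟨y, hy.mem, x, hx.mem, rfl⟩)

theorem lieRelations_le_lieTensor : lieRelations K d ≤ lieTensor K d := by
  intro F hF
  refine map_closedSpan (ContinuousLinearMap.id K _) (isClosed_closedSpan _) ?_ F hF
  rintro _ (⟨x, hx, y, hy, rfl⟩ | ⟨x, hx, y, hy, z, hz, rfl⟩)
  · have h : tmul x y ∈ lieTensor K d := subset_closedSpan _ ⟨x, hx, y, hy, rfl⟩
    exact sub_mem h (swap_mem_lieTensor h)
  · exact sub_mem (subset_closedSpan _ ⟨x, hx, _, bracket_mem d hy hz, rfl⟩)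
      (subset_closedSpan _ ⟨_, bracket_mem d hx hy, z, hz, rfl⟩)

theorem mu_sub_mu_swap_mem (F : Pro K (List I × List I)) :
    mu F - mu (swap d F) ∈ commutators K d := by
  refine mem_of_single (mu - mu.comp (swap d)) (T := commutators K d) (isClosed_closedSpan _)
    (fun p => ?_) F
  obtain ⟨u, v⟩ := p
  rw [single_prod]
  exact subset_closedSpan _ ⟨single u, single v, rfl⟩

theorem exists_of_mem_lieFilt_three {f : TSeries K I} (hf : f ∈ lieFilt K d 3) :
    ∃ c : K, ∃ x ∈ lieSeries K d, ∃ F ∈ lieTensor K d, f = c • single [] + x + mu F := by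
  have : lieFilt K d 3 ≤ Submodule.span K {single []} ⊔ lieSeries K d ⊔
      (lieTensor K d).map mu.toLinearMap := by
    refine Submodule.span_le.2 ?_
    rintro _ ⟨n, hn, hf⟩
    cases hf with
    | one => exact Submodule.mem_sup_left (Submodule.mem_sup_left
        (Submodule.mem_span_singleton_self _))
    | @mul _ x g hx hg =>
      cases hg with
      | one =>
        rw [mul_one']
        exact Submodule.mem_sup_left (Submodule.mem_sup_right hx.mem)
      | @mul _ y h hy hh =>
        cases hh with
        | one =>
          rw [mul_one']
          exact Submodule.mem_sup_right
            ⟨tmul x y, subset_closedSpan _ ⟨x, hx.mem, y, hy.mem, rfl⟩, rfl⟩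
        | mul => omega
  obtain ⟨g, hg, _, ⟨F, hF, rfl⟩, rfl⟩ := Submodule.mem_sup.1 (this hf)
  obtain ⟨_, hc, x, hx, rfl⟩ := Submodule.mem_sup.1 hg
  obtain ⟨c, rfl⟩ := Submodule.mem_span_singleton.1 hc
  exact ⟨c, x, hx, F, hF, rfl⟩

end Filtration

/-! ### The operator `e(2)` -/

section Hodge

variable {K : Type*} [CommRing K] [Algebra ℚ K] {I : Type*} {d : I → ℤ}

open Pro Polynomial

theorem mem_of_ratCast_smul_mem {Y : Type*} {S : Submodule K (Pro K Y)} {q : ℚ} (hq : q ≠ 0)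
    {f : Pro K Y} (h : algebraMap ℚ K q • f ∈ S) : f ∈ S := by
  have := S.smul_mem (algebraMap ℚ K q⁻¹) h
  rwa [smul_smul, ← map_mul, inv_mul_cancel₀ hq, map_one, one_smul] at this

/-- Evaluation of rational polynomials at the shuffle operator. -/
def shuffleCalc (K : Type*) [CommRing K] [Algebra ℚ K] {I : Type*} (d : I → ℤ) :
    ℚ[X] →+* Module.End K (TSeries K I) :=
  (aeval (R := K) (shuffleOp d : Module.End K (TSeries K I))).toRingHom.comp
    (mapRingHom (algebraMap ℚ K))

theorem shuffleCalc_C (q : ℚ) (f : TSeries K I) :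
    shuffleCalc K d (C q) f = algebraMap ℚ K q • f := by
  change aeval (shuffleOp d) (Polynomial.map (algebraMap ℚ K) (C q)) f = _
  rw [Polynomial.map_C, aeval_C]
  rfl

theorem shuffleCalc_X : shuffleCalc K d X = shuffleOp d := by
  change aeval (shuffleOp d) (Polynomial.map (algebraMap ℚ K) X) = _
  rw [Polynomial.map_X, aeval_X]

theorem shuffleCalc_mul (P Q : ℚ[X]) (f : TSeries K I) :
    shuffleCalc K d (P * Q) f = shuffleCalc K d P (shuffleCalc K d Q f) := by
  rw [map_mul]; rfl

@[elab_as_elim]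
theorem polynomial_induction {motive : ℚ[X] → Prop} (P : ℚ[X]) (const : ∀ q, motive (C q))
    (add : ∀ P Q, motive P → motive Q → motive (P + Q))
    (mul_X : ∀ P, motive P → motive (P * X)) : motive P :=
  Polynomial.induction_on P const add fun n a h => by
    rw [pow_succ, ← mul_assoc]; exact mul_X _ h

theorem shuffleCalc_mem (S : AddSubgroup (TSeries K I)) (h1 : ∀ f ∈ S, shuffleOp d f ∈ S)
    (h2 : ∀ q : ℚ, ∀ f ∈ S, algebraMap ℚ K q • f ∈ S) (P : ℚ[X]) {f : TSeries K I} (hf : f ∈ S) :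
    shuffleCalc K d P f ∈ S := by
  induction P using polynomial_induction generalizing f with
  | const q => rw [shuffleCalc_C]; exact h2 q f hf
  | add P Q hP hQ => rw [map_add]; exact add_mem (hP hf) (hQ hf)
  | mul_X P hP => rw [shuffleCalc_mul, shuffleCalc_X]; exact hP (h1 f hf)

theorem shuffleCalc_commute {δ : TSeries K I →L[K] TSeries K I}
    (h : ∀ f, shuffleOp d (δ f) = δ (shuffleOp d f)) (P : ℚ[X]) (f : TSeries K I) :
    shuffleCalc K d P (δ f) = δ (shuffleCalc K d P f) := by
  induction P using polynomial_induction generalizing f with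
  | const q => rw [shuffleCalc_C, shuffleCalc_C, map_smul]
  | add P Q hP hQ => rw [map_add, LinearMap.add_apply, LinearMap.add_apply, map_add, hP, hQ]
  | mul_X P hP => rw [shuffleCalc_mul, shuffleCalc_mul, shuffleCalc_X, h, hP]

theorem continuous_shuffleCalc (P : ℚ[X]) :
    Continuous fun f : TSeries K I => shuffleCalc K d P f := by
  induction P using polynomial_induction with
  | const q =>
    simp only [shuffleCalc_C]
    exact continuous_const_smul _
  | add P Q hP hQ =>
    simp only [map_add, LinearMap.add_apply]
    exact hP.add hQ
  | mul_X P hP =>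
    simp only [shuffleCalc_mul, shuffleCalc_X]
    exact hP.comp (shuffleL d).continuous

theorem shuffleCalc_of_eigen {f : TSeries K I} {q : ℚ}
    (h : shuffleOp d f = algebraMap ℚ K q • f) (P : ℚ[X]) :
    shuffleCalc K d P f = algebraMap ℚ K (P.eval q) • f := by
  induction P using polynomial_induction with
  | const a => rw [shuffleCalc_C, eval_C]
  | add P Q hP hQ => rw [map_add, LinearMap.add_apply, hP, hQ, eval_add, map_add, add_smul]
  | mul_X P hP =>
    rw [shuffleCalc_mul, shuffleCalc_X, h, map_smul, hP, smul_smul, ← map_mul, eval_mul, eval_X,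
      mul_comm]

theorem suppOn_shuffleCalc {n : ℕ} {f : TSeries K I} (hf : SuppOn List.length n f) (P : ℚ[X]) :
    SuppOn List.length n (shuffleCalc K d P f) := by
  let S : AddSubgroup (TSeries K I) :=
    { carrier := {f | SuppOn List.length n f}
      add_mem' := SuppOn.add
      zero_mem' := fun _ _ => rfl
      neg_mem' := fun {f} hf w hw => by
        change -f w = 0
        rw [hf w hw, neg_zero] }
  refine shuffleCalc_mem S (fun f hf w hw => ?_) (fun q f hf => SuppOn.smul _ hf) P hf
  refine shuffleOp_apply_mem d (⊥ : AddSubgroup K) fun w' hw' => hf w' ?_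
  rwa [hw'.length_eq]

/-- Each factor `s - 2 ^ r` lowers the filtration by the number of Lie factors by one. -/
theorem shuffleCalc_nodal (n : ℕ) {f : TSeries K I} (hf : f ∈ lieFilt K d n) :
    shuffleCalc K d (∏ r ∈ Finset.range n, (X - C ((2 : ℚ) ^ r))) f = 0 := by
  induction n generalizing f with
  | zero =>
    rw [lieFilt_zero, Submodule.mem_bot] at hf
    rw [hf, map_zero]
  | succ n ih =>
    rw [Finset.prod_range_succ, shuffleCalc_mul]
    refine ih ?_
    have := shuffleOp_sub_mem_lieFilt hf
    rw [map_sub, LinearMap.sub_apply, shuffleCalc_X, shuffleCalc_C, map_pow, map_ofNat]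
    exact this

theorem pow_two_injective : Function.Injective fun r : ℕ => (2 : ℚ) ^ r :=
  pow_right_injective₀ two_pos (by norm_num)

/-- A polynomial in the shuffle operator annihilates the products of fewer than `n` Lie monomials
if it vanishes at `2 ^ 0, …, 2 ^ (n - 1)`. -/
theorem shuffleCalc_eq_zero {n : ℕ} {f : TSeries K I} (hf : f ∈ lieFilt K d n) {P : ℚ[X]}
    (hP : ∀ r < n, P.eval ((2 : ℚ) ^ r) = 0) : shuffleCalc K d P f = 0 := by
  obtain ⟨Q, rfl⟩ : ∏ r ∈ Finset.range n, (X - C ((2 : ℚ) ^ r)) ∣ P :=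
    Finset.prod_dvd_of_coprime
      (fun i _ j _ hij => pairwise_coprime_X_sub_C pow_two_injective hij)
      fun r hr => dvd_iff_isRoot.2 (hP r (Finset.mem_range.1 hr))
  rw [mul_comm, shuffleCalc_mul, shuffleCalc_nodal n hf, map_zero]

/-- The polynomial defining `e(2)` on words of length `n`. -/
def hodgePoly (n : ℕ) : ℚ[X] :=
  if 2 ≤ n then Lagrange.basis (Finset.range (n + 1)) (fun r : ℕ => (2 : ℚ) ^ r) 2 else 0

theorem eval_hodgePoly {n r : ℕ} (hr : r ≤ n) :
    (hodgePoly n).eval ((2 : ℚ) ^ r) = if r = 2 then 1 else 0 := by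
  have hr' : r ∈ Finset.range (n + 1) := Finset.mem_range.2 (by omega)
  rw [hodgePoly]
  by_cases h : r = 2
  · subst h
    rw [if_pos hr, if_pos rfl]
    exact Lagrange.eval_basis_self pow_two_injective.injOn hr'
  · rw [if_neg h]
    split_ifs
    · exact Lagrange.eval_basis_of_ne (Ne.symm h) hr'
    · exact eval_zero

theorem hodgeIdem_two_apply (f : TSeries K I) (w : List I) :
    hodgeIdem d 2 f w = shuffleCalc K d (hodgePoly w.length) f w := by
  change hodgeComp d w.length 2 f w = _
  rw [hodgeComp, hodgePoly]
  split_ifs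
  · rfl
  · rw [map_zero]

/-- The operator `e(2)` as a continuous map. -/
def hodgeL (K : Type*) [CommRing K] [Algebra ℚ K] {I : Type*} (d : I → ℤ) :
    TSeries K I →L[K] TSeries K I where
  __ := hodgeIdem d 2
  cont := by
    let _ : TopologicalSpace K := ⊥
    refine continuous_of_coord fun w => ?_
    have : (fun f : TSeries K I => hodgeIdem d 2 f w) =
        fun f => shuffleCalc K d (hodgePoly w.length) f w :=
      funext fun f => hodgeIdem_two_apply f w
    change Continuous fun f : TSeries K I => hodgeIdem d 2 f w
    rw [this]
    exact (continuous_coord w).comp (continuous_shuffleCalc _)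

theorem hodgeL_coord (f : TSeries K I) (w : List I) :
    hodgeL K d f w = shuffleCalc K d (hodgePoly w.length) f w := hodgeIdem_two_apply f w

theorem hodgeL_of_suppOn {n : ℕ} {f : TSeries K I} (hf : SuppOn List.length n f) :
    hodgeL K d f = shuffleCalc K d (hodgePoly n) f := by
  funext w
  rw [hodgeL_coord]
  by_cases h : w.length = n
  · rw [h]
  · rw [suppOn_shuffleCalc hf _ w h, suppOn_shuffleCalc hf _ w h]

theorem hodgeL_nil (f : TSeries K I) : hodgeL K d f [] = 0 := by
  rw [hodgeL_coord, hodgePoly, if_neg (by simp), map_zero]; rfl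

theorem hodgeL_commutators {f : TSeries K I} (hf : f ∈ commutators K d) :
    hodgeL K d f ∈ commutators K d := by
  refine map_commutators (hodgeL K d) (isClosed_closedSpan _) (fun a w => ?_) hf
  have h : SuppOn List.length (1 + w.length) (bracket d (gen a) (single w) : TSeries K I) :=
    (suppOn_single (wdeg d) [a]).bracket_length (suppOn_single (wdeg d) w)
      (suppOn_single List.length [a]) (suppOn_single List.length w)
  rw [hodgeL_of_suppOn h, ← bracketR_apply,
    shuffleCalc_commute (δ := bracketR d (gen a)) (shuffleOp_bracket_gen d a)]
  exact subset_closedSpan _ ⟨_, _, rfl⟩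

/-- On products of two Lie series, `e(2)` is the identity modulo commutators. -/
theorem hodgeL_mu_sub_mem {F : Pro K (List I × List I)} (hF : F ∈ lieTensor K d) :
    hodgeL K d (mu F) - mu F ∈ commutators K d := by
  refine lieTensor_map_mem ((hodgeL K d).comp mu - mu) (T := commutators K d)
    (isClosed_closedSpan _) (fun x y hx hy => ?_) hF
  change hodgeL K d (mu (tmul x y)) - mu (tmul x y) ∈ commutators K d
  obtain ⟨p, j, hj0, hp, hj⟩ := hx.exists_suppOn
  obtain ⟨q, k, hk0, hq, hk⟩ := hy.exists_suppOn
  have hT : tmul x y ∈ lieTensor K d := subset_closedSpan _ ⟨x, hx.mem, y, hy.mem, rfl⟩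
  set b := mu (tmul x y) - mu (swap d (tmul x y)) with hb
  have hbC : b ∈ commutators K d := mu_sub_mu_swap_mem _
  -- the symmetric product is an eigenvector of the shuffle operator for the eigenvalue `4`
  set h := mu (tmul x y) + mu (swap d (tmul x y)) with hh
  have hs : shuffleOp d h = algebraMap ℚ K (2 ^ 2) • h := by
    have e := shuffleOp_mu (add_mem hT (swap_mem_lieTensor hT))
    rw [map_add (swap d), swap_swap, map_add mu, map_add mu] at e
    rw [hh, e, add_comm (mu (swap d (tmul x y))) (mu (tmul x y)), map_pow, map_ofNat]
    module
  have hl : SuppOn List.length (j + k) h := by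
    refine SuppOn.add (hj.mul (fun _ _ => List.length_append) hk) ?_
    rw [swap_tmul_of_suppOn hp hq, map_smul, add_comm]
    exact SuppOn.smul _ (hk.mul (fun _ _ => List.length_append) hj)
  have he : hodgeL K d h = h := by
    rw [hodgeL_of_suppOn hl, shuffleCalc_of_eigen hs, eval_hodgePoly (by omega), if_pos rfl,
      map_one, one_smul]
  refine mem_of_ratCast_smul_mem (q := 2) two_ne_zero ?_
  have e2 : algebraMap ℚ K 2 • mu (tmul x y) = h + b := by
    rw [map_ofNat, two_smul, hh, hb]; abel
  rw [smul_sub, ← map_smul, e2, map_add, he, add_sub_add_left_eq_sub]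
  exact sub_mem (hodgeL_commutators hbC) hbC

/-- On a word, `e(2)` takes values in the eigenspace of the shuffle operator for the eigenvalue `4`,
which consists of products of two Lie series, up to commutators. -/
theorem exists_hodgeL_single_sub_mem (w : List I) :
    ∃ F ∈ lieTensor K d, hodgeL K d (single w) - mu F ∈ commutators K d := by
  rw [hodgeL_of_suppOn (suppOn_single List.length w)]
  by_cases hn : 2 ≤ w.length
  swap
  · refine ⟨0, zero_mem _, ?_⟩
    rw [hodgePoly, if_neg hn, map_zero, map_zero, sub_zero]
    exact zero_mem _
  set g := shuffleCalc K d (hodgePoly w.length) (single w) with hg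
  have hs : shuffleOp d g = (4 : K) • g := by
    have h0 : shuffleCalc K d ((X - C ((2 : ℚ) ^ 2)) * hodgePoly w.length) (single w) = 0 := by
      refine shuffleCalc_eq_zero (single_mem_lieFilt d w) fun r hr => ?_
      rw [eval_mul, eval_hodgePoly (by omega)]
      by_cases h : r = 2 <;> simp [h]
    rw [shuffleCalc_mul, map_sub, LinearMap.sub_apply, shuffleCalc_X, shuffleCalc_C, ← hg,
      sub_eq_zero, map_pow, map_ofNat] at h0
    rw [h0]
    norm_num
  have hmem : g ∈ lieFilt K d (w.length + 1) :=
    shuffleCalc_mem (lieFilt K d (w.length + 1)).toAddSubgroup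
      (fun f hf => shuffleOp_mem_lieFilt hf) (fun q f hf => Submodule.smul_mem _ _ hf) _
      (single_mem_lieFilt d w)
  -- `(4 - 2 ^ j) g = (s - 2 ^ j) g` has one factor less, so `g` descends to two factors
  have hdesc : ∀ k, g ∈ lieFilt K d (3 + k) → g ∈ lieFilt K d 3 := by
    intro k
    induction k with
    | zero => exact id
    | succ k ih =>
      intro h
      refine ih (mem_of_ratCast_smul_mem (q := 4 - 2 ^ (3 + k)) ?_ ?_)
      · have : (8 : ℚ) ≤ 2 ^ (3 + k) := by
          rw [pow_add]
          nlinarith [one_le_pow₀ (one_le_two : (1 : ℚ) ≤ 2) (n := k)]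
        linarith
      · have := shuffleOp_sub_mem_lieFilt h
        rw [hs, ← sub_smul] at this
        rwa [map_sub, map_pow, map_ofNat, map_ofNat]
  obtain ⟨c, x, hx, F, hF, hgF⟩ := exists_of_mem_lieFilt_three
    (hdesc (w.length - 2) (by rwa [show 3 + (w.length - 2) = w.length + 1 by omega]))
  have hw0 : g [] = 0 := suppOn_shuffleCalc (suppOn_single List.length w) _ [] (by
    simp only [List.length_nil]; omega)
  have hc : c = 0 := by
    rw [hgF] at hw0
    have hF0 : mu F [] = 0 := mu_mem_augIdeal hF
    simpa [hF0, nil_of_mem_lieSeries hx, single_apply_self] using hw0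
  subst hc
  rw [zero_smul, zero_add] at hgF
  refine ⟨F, hF, ?_⟩
  rw [hgF, add_sub_cancel_right]
  -- comparing both sides of `s g = 4 g`, the Lie series `2 x` is a commutator
  rw [hgF, map_add, shuffleOp_lie hx, shuffleOp_mu hF] at hs
  refine mem_of_ratCast_smul_mem (q := 2) two_ne_zero ?_
  have e : algebraMap ℚ K 2 • x = -(mu F - mu (swap d F)) := by
    rw [map_ofNat]
    have h4 : (4 : K) • (x + mu F) = (2 : K) • x + (2 : K) • x + ((3 : K) • mu F + mu F) := by
      module
    rw [h4, add_assoc, add_right_inj] at hs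
    have h5 : (2 : K) • x + ((3 : K) • mu F + mu F) = (3 : K) • mu F + mu (swap d F) := hs.symm
    have h6 : (2 : K) • x = (3 : K) • mu F + mu (swap d F) - ((3 : K) • mu F + mu F) :=
      eq_sub_of_add_eq h5
    rw [h6]
    abel
  rw [e]
  exact neg_mem (mu_sub_mu_swap_mem F)

theorem normCycDeriv_hodgeL_mem (f : TSeries K I) :
    normCycDeriv d (hodgeL K d f) ∈ lieTensor K d := by
  refine mem_of_single ((normCycDeriv d).comp (hodgeL K d)) (isClosed_closedSpan _) (fun w => ?_) f
  obtain ⟨F, hF, h⟩ := exists_hodgeL_single_sub_mem (K := K) (d := d) w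
  have h1 := normCycDeriv_commutators h
  rw [map_sub, sub_eq_zero] at h1
  rw [ContinuousLinearMap.comp_apply, h1]
  have := add_mem (lieRelations_le_lieTensor (normCycDeriv_mu_sub_mem hF)) hF
  rwa [sub_add_cancel] at this

theorem mu_normCycDeriv_hodgeL_sub_mem (f : TSeries K I) :
    mu (normCycDeriv d (hodgeL K d f)) - hodgeL K d f ∈ commutators K d :=
  mu_normCycDeriv_sub_mem (hodgeL_nil f)

end Hodge

/-! ### Compatibility with degrees and with the vector field -/

section Degree

variable {K : Type*} [CommRing K] {I : Type*} {𝒦 : ℤ → AddSubgroup K} {d : I → ℤ}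

open Pro

theorem mu_mem_homog {n : ℤ} {F : Pro K (List I × List I)}
    (hF : F ∈ homog 𝒦 (fun p : List I × List I => wdeg d p.1 + wdeg d p.2) n) :
    mu F ∈ homog 𝒦 (wdeg d) n := by
  intro w
  rw [mu_apply]
  refine sum_mem fun k _ => ?_
  have h : F (w.take k, w.drop k) ∈ 𝒦 (n - (wdeg d (w.take k) + wdeg d (w.drop k))) :=
    hF (w.take k, w.drop k)
  rwa [← wdeg_append, List.take_append_drop] at h

theorem mul_rotWord_mem (d : I → ℤ) (S : AddSubgroup K) {a : K} (ha : a ∈ S) (y x : List I)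
    (p : List I × List I) : a * rotWord d y x p ∈ S := by
  classical
  induction y generalizing x with
  | nil =>
    change a * 0 ∈ S
    rw [mul_zero]
    exact zero_mem _
  | cons b y ih =>
    rw [rotWord, Pro.add_apply, Pro.smul_apply, mul_add, mul_left_comm]
    refine add_mem ?_ (sg_mul_mem_addSubgroup S _ (ih _))
    by_cases h : p = ([b], y ++ x)
    · rwa [h, single_apply_self, mul_one]
    · rw [single_apply_ne h, mul_zero]
      exact zero_mem _

theorem cycDeriv_mem_homog {n : ℤ} {f : TSeries K I} (hf : f ∈ homog 𝒦 (wdeg d) n) :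
    cycDeriv d f ∈ homog 𝒦 (fun p : List I × List I => wdeg d p.1 + wdeg d p.2) n := by
  intro p
  change rot d (tmul f (single [])) p ∈ 𝒦 (n - (wdeg d p.1 + wdeg d p.2))
  rw [rot, ofBasis_apply]
  refine sum_mem fun q _ => ?_
  obtain ⟨y, x⟩ := q
  rw [tmul_apply]
  by_cases hx : x = []
  · subst hx
    rw [single_apply_self, mul_one]
    by_cases hp : wdeg d p.1 + wdeg d p.2 = wdeg d y + wdeg d []
    · refine mul_rotWord_mem d _ ?_ y [] p
      rw [hp, wdeg_nil, add_zero]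
      exact hf y
    · rw [rotWord_wdeg d y [] p hp, mul_zero]
      exact zero_mem _
  · rw [single_apply_ne hx, mul_zero, zero_mul]
    exact zero_mem _

variable [Algebra ℚ K] [GradedRing 𝒦]

/-- The rational numbers lie in `K₀`: the projection of `K` to `Kₙ` is additive, hence `ℚ`-linear. -/
theorem algebraMap_rat_mul_mem {n : ℤ} {a : K} (ha : a ∈ 𝒦 n) (q : ℚ) :
    algebraMap ℚ K q * a ∈ 𝒦 n := by
  have h1 : GradedRing.proj 𝒦 n a = a := by
    rw [GradedRing.proj_apply]
    exact DirectSum.decompose_of_mem_same 𝒦 ha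
  rw [← Algebra.smul_def, ← h1, ← map_rat_smul, GradedRing.proj_apply]
  exact SetLike.coe_mem _

theorem normCycDeriv_mem_homog {n : ℤ} {f : TSeries K I} (hf : f ∈ homog 𝒦 (wdeg d) n) :
    normCycDeriv d f ∈ homog 𝒦 (fun p : List I × List I => wdeg d p.1 + wdeg d p.2) n :=
  fun p => algebraMap_rat_mul_mem (cycDeriv_mem_homog hf p) _

theorem hodgeL_mem_homog {n : ℤ} {f : TSeries K I} (hf : f ∈ homog 𝒦 (wdeg d) n) :
    hodgeL K d f ∈ homog 𝒦 (wdeg d) n := by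
  intro w
  rw [hodgeL_coord]
  refine shuffleCalc_mem (homog 𝒦 (wdeg d) n) (fun f hf w => ?_)
    (fun q f hf w => algebraMap_rat_mul_mem (hf w) q) _ hf w
  refine shuffleOp_apply_mem d (𝒦 (n - wdeg d w)) fun w' hw' => ?_
  have h : wdeg d w' = wdeg d w := (hw'.map d).sum_eq
  rw [← h]
  exact hf w'

end Degree

section VectorField

variable {K : Type*} [CommRing K] {I : Type*} {𝒦 : ℤ → AddSubgroup K} {d : I → ℤ}
  (Q : HomologicalLieField 𝒦 d)

open Pro

namespace HomologicalLieField

/-- The vector field does not lower the length of words, as the Lie series `m(tᵢ)` have no constant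
term. -/
theorem extend_apply_of_length_lt {n : ℕ} {f : TSeries K I} (hf : SuppOn List.length n f)
    {v : List I} (hv : v.length < n) : Q.extend f v = 0 := by
  classical
  have hw : ∀ w v : List I, v.length < w.length → Q.extend (single w) v = 0 := by
    intro w
    induction w with
    | nil => intro v hv; simp at hv
    | cons a w ih =>
      intro v hv
      have h1 : mul (Q.onGen a) (single w) v = 0 := by
        rw [mul, mu_apply]
        refine Finset.sum_eq_zero fun k _ => ?_
        rw [tmul_apply]
        by_cases hk : v.drop k = w
        · have hl : (v.take k).length = 0 := by
            have h2 := congrArg List.length (List.take_append_drop k v)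
            rw [List.length_append, hk] at h2
            rw [List.length_cons] at hv
            omega
          rw [List.length_eq_zero_iff.1 hl, nil_of_mem_lieSeries (Q.onGen_mem a), zero_mul]
        · rw [single_apply_ne hk, mul_zero]
      rw [extend_single_cons, Pro.add_apply, Pro.smul_apply, h1, zero_add]
      cases v with
      | nil => rw [mul_gen_nil, mul_zero]
      | cons b v =>
        rw [mul_gen_cons, ih v (by simpa using hv), mul_zero, mul_zero]
  let A : TSeries K I →L[K] Pro K Unit := pull fun _ => v
  have h := hf.map_mem (A.comp Q.extend) (T := ⊥) (by simp)
    (by rintro w rfl; exact (Submodule.mem_bot K).2 (Pro.ext fun _ => hw w v hv))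
  have h' : A (Q.extend f) = 0 := (Submodule.mem_bot K).1 h
  exact congrFun h' ()

variable [GradedRing 𝒦] [EvenlyGraded 𝒦]

theorem isDeriv_extend : IsDeriv d 1 Q.extend where
  map_mul := Q.extend_mul
  map_twist j f := by rw [mul_one]; exact Q.extend_twist j f

theorem shuffleOp_extend (f : TSeries K I) :
    shuffleOp d (Q.extend f) = Q.extend (shuffleOp d f) :=
  Q.isDeriv_extend.shuffleOp_apply (fun a => by rw [extend_gen]; exact Q.onGen_mem a) f

variable [Algebra ℚ K]

/-- The operator `e(2)` commutes with the vector field. The polynomials which define `e(2)` depend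
on the length of words, but those for longer words agree on a given word, as they have the same
values at the eigenvalues of the shuffle operator which occur there. -/
theorem hodgeL_extend (f : TSeries K I) :
    hodgeL K d (Q.extend f) = Q.extend (hodgeL K d f) := by
  have : (hodgeL K d).comp Q.extend = Q.extend.comp (hodgeL K d) := hom_ext fun w => by
    have hw : SuppOn List.length w.length (single w : TSeries K I) := suppOn_single List.length w
    funext v
    change hodgeL K d (Q.extend (single w)) v = Q.extend (hodgeL K d (single w)) v
    rw [hodgeL_coord, shuffleCalc_commute Q.shuffleOp_extend, hodgeL_of_suppOn hw]
    rcases lt_or_ge v.length w.length with h | h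
    · rw [Q.extend_apply_of_length_lt (suppOn_shuffleCalc hw _) h,
        Q.extend_apply_of_length_lt (suppOn_shuffleCalc hw _) h]
    · have e : shuffleCalc K d (hodgePoly v.length - hodgePoly w.length) (single w) = 0 := by
        refine shuffleCalc_eq_zero (single_mem_lieFilt d w) fun r hr => ?_
        rw [Polynomial.eval_sub, eval_hodgePoly (by omega), eval_hodgePoly (by omega), sub_self]
      rw [map_sub, LinearMap.sub_apply, sub_eq_zero] at e
      rw [e]
  exact congrArg (· f) this

end HomologicalLieField

end VectorField

/-! ### The retraction of the cyclic Hochschild complex onto the cyclic Harrison complex -/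

section Retraction

universe u v

variable {K : Type u} [CommRing K] {I : Type v} {𝒦 : ℤ → AddSubgroup K} {d : I → ℤ}
  [GradedRing 𝒦] [EvenlyGraded 𝒦] (Q : HomologicalLieField 𝒦 d)

open Pro

namespace HomologicalLieField

theorem isChainMap_lieToAss : TopComplex.IsChainMap Q.lieToAss where
  map_gr := by
    rintro n _ ⟨F, hF, rfl⟩
    exact ⟨mu F.1, mu_mem_homog hF, rfl⟩
  map_d x := by
    induction x using Submodule.Quotient.induction_on with
    | _ F =>
      refine Subtype.ext ?_
      change (Submodule.Quotient.mk (mu (Q.tensorOp F.1)) : AssZeroForms K d) =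
        Submodule.Quotient.mk (Q.extend (mu F.1))
      rw [extend_mu]

variable [Algebra ℚ K]

/-- The retraction of `l`, induced by `f ↦ D(e(2) f)` for the normalised cyclic derivative `D`. -/
def retraction : Q.cyclicHochschild →L[K] Q.cyclicHarrison :=
  ((commutators K d).liftQL
    (((lieRelations K d).submoduleOf (lieTensor K d)).mkQL.comp
      (((normCycDeriv d).comp (hodgeL K d)).codRestrict (lieTensor K d) normCycDeriv_hodgeL_mem))
    fun f hf => by
      refine (Submodule.Quotient.mk_eq_zero _).2 ?_
      change normCycDeriv d (hodgeL K d f) ∈ lieRelations K d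
      rw [normCycDeriv_commutators (hodgeL_commutators hf)]
      exact zero_mem _).comp (vanishing K d).subtypeL

theorem retraction_lieToAss (x : Q.cyclicHarrison) : Q.retraction (Q.lieToAss x) = x := by
  induction x using Submodule.Quotient.induction_on with
  | _ F =>
    refine (Submodule.Quotient.eq _).2 ?_
    change normCycDeriv d (hodgeL K d (mu F.1)) - F.1 ∈ lieRelations K d
    have h := normCycDeriv_commutators (hodgeL_mu_sub_mem F.2)
    rw [map_sub, sub_eq_zero] at h
    rw [h]
    exact normCycDeriv_mu_sub_mem F.2

theorem lieToAss_injective : Function.Injective Q.lieToAss :=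
  Function.LeftInverse.injective Q.retraction_lieToAss

theorem lieToAss_retraction_mk (f : TSeries K I)
    (hf : Submodule.Quotient.mk f ∈ vanishing K d) :
    (Q.lieToAss (Q.retraction ⟨Submodule.Quotient.mk f, hf⟩)).1 =
      Submodule.Quotient.mk (hodgeL K d f) :=
  (Submodule.Quotient.eq _).2 (mu_normCycDeriv_hodgeL_sub_mem f)

theorem isChainMap_retraction : TopComplex.IsChainMap Q.retraction where
  map_gr := by
    rintro n ⟨q, hq⟩ ⟨f, hf, rfl⟩
    exact ⟨⟨normCycDeriv d (hodgeL K d f), normCycDeriv_hodgeL_mem f⟩,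
      normCycDeriv_mem_homog (hodgeL_mem_homog hf), rfl⟩
  map_d := by
    -- `l` is injective, and `l` composed with the retraction is induced by `e(2)`
    rintro ⟨q, hq⟩
    induction q using Submodule.Quotient.induction_on with
    | _ f =>
      refine Q.lieToAss_injective ?_
      rw [Q.isChainMap_lieToAss.map_d]
      refine Subtype.ext ?_
      have h1 : (Q.cyclicHochschild.d (Q.lieToAss
          (Q.retraction ⟨Submodule.Quotient.mk f, hq⟩))).1 =
          Q.assLieDeriv (Q.lieToAss (Q.retraction ⟨Submodule.Quotient.mk f, hq⟩)).1 := rfl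
      rw [h1, lieToAss_retraction_mk, assLieDeriv_mk, ← hodgeL_extend]
      exact Q.lieToAss_retraction_mk (Q.extend f) (Q.assLieDeriv_mem (Submodule.Quotient.mk f))

theorem lieToAss_mem_hodgeSummand (x : Q.cyclicHarrison) : Q.lieToAss x ∈ Q.hodgeSummand 1 := by
  induction x using Submodule.Quotient.induction_on with
  | _ F =>
    exact ⟨hodgeL K d (mu F.1), ⟨mu F.1, rfl⟩,
      (Submodule.Quotient.eq _).2 (hodgeL_mu_sub_mem F.2)⟩

/-- The Hodge summand is the image of `l`, and `l` composed with the retraction is the identity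
there. -/
theorem lieToAss_retraction {q : Q.cyclicHochschild} (hq : q ∈ Q.hodgeSummand 1) :
    Q.lieToAss (Q.retraction q) = q := by
  obtain ⟨q, hq'⟩ := q
  obtain ⟨_, ⟨f, rfl⟩, h⟩ := hq
  have hx : ∃ x, Q.lieToAss x = ⟨q, hq'⟩ := by
    refine ⟨Submodule.Quotient.mk ⟨normCycDeriv d (hodgeL K d f), normCycDeriv_hodgeL_mem f⟩,
      Subtype.ext (Eq.trans ?_ h)⟩
    exact (Submodule.Quotient.eq _).2 (mu_normCycDeriv_hodgeL_sub_mem f)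
  obtain ⟨x, hx⟩ := hx
  rw [← hx, retraction_lieToAss]

theorem d_mem_hodgeSummand (q : Q.cyclicHochschild) (hq : q ∈ Q.hodgeSummand 1) :
    Q.cyclicHochschild.d q ∈ Q.hodgeSummand 1 := by
  rw [← Q.lieToAss_retraction hq, ← Q.isChainMap_lieToAss.map_d]
  exact Q.lieToAss_mem_hodgeSummand _

/-- The isomorphism of the cyclic Harrison complex with the Hodge summand. -/
def harrisonEquiv : Q.cyclicHarrison ≃L[K]
    Q.cyclicHochschild.sub (Q.hodgeSummand 1) Q.d_mem_hodgeSummand :=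
  ContinuousLinearEquiv.equivOfInverse
    (M₂ := Q.cyclicHochschild.sub (Q.hodgeSummand 1) Q.d_mem_hodgeSummand)
    (Q.lieToAss.codRestrict (Q.hodgeSummand 1) Q.lieToAss_mem_hodgeSummand)
    (Q.retraction.comp (Q.cyclicHochschild.subIncl (Q.hodgeSummand 1) Q.d_mem_hodgeSummand))
    Q.retraction_lieToAss
    fun q => Subtype.ext (Q.lieToAss_retraction q.2)

end HomologicalLieField

end Retraction

end FormalNC

end

theorem mainTheorem6 {K : Type*} [CommRing K] [Algebra ℚ K] (𝒦 : ℤ → AddSubgroup K)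
    [GradedRing 𝒦] [FormalNC.EvenlyGraded 𝒦] {I : Type*} (deg : I → ℤ)
    (m : FormalNC.CInfinityStructure 𝒦 deg) :
    FormalNC.TopComplex.IsChainMap m.lieToAss ∧
    ∃ h : ∀ q ∈ m.hodgeSummand 1, m.cyclicHochschild.d q ∈ m.hodgeSummand 1,
      (∃ φ : m.cyclicHarrison ≃L[K] m.cyclicHochschild.sub (m.hodgeSummand 1) h,
        FormalNC.TopComplex.IsChainMap
          (φ : m.cyclicHarrison →L[K] m.cyclicHochschild.sub (m.hodgeSummand 1) h) ∧
        FormalNC.TopComplex.IsChainMap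
          (φ.symm : m.cyclicHochschild.sub (m.hodgeSummand 1) h →L[K] m.cyclicHarrison) ∧
        ∀ x, m.cyclicHochschild.subIncl (m.hodgeSummand 1) h (φ x) = m.lieToAss x) ∧
      ∃ r : m.cyclicHochschild →L[K] m.cyclicHarrison,
        FormalNC.TopComplex.IsChainMap r ∧ ∀ x, r (m.lieToAss x) = x := by
  refine ⟨m.isChainMap_lieToAss, m.d_mem_hodgeSummand,
    ⟨m.harrisonEquiv, ⟨?_, ?_⟩, ⟨?_, ?_⟩, fun x => rfl⟩,
    m.retraction, m.isChainMap_retraction, m.retraction_lieToAss⟩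
  · exact fun n x hx => m.isChainMap_lieToAss.map_gr n x hx
  · exact fun x => Subtype.ext (m.isChainMap_lieToAss.map_d x)
  · exact fun n x hx => m.isChainMap_retraction.map_gr n x.1 hx
  · exact fun x => m.isChainMap_retraction.map_d x.1
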